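/- All rings are commutative with $1$. Let $R$ be an integral domain that is not a field, with quotient field $K$. For $R$-submodules $I,J$ of $K$ put $I:J=\{x\in K : xJ\subseteq I\}$, and let $R^{*}$ be the complete integral closure of $R$ in $K$, i.e. the ring of all $x\in K$ for which there is a nonzero $r\in R$ with $rx^{m}\in R$ for all $m\ge 0$. Definitions. An ideal $I$ of $R$ is 2-absorbing if $abc\in I$ (with $a,b,c\in R$) implies $ab\in I$, $ac\in I$ or $bc\in I$; $R$ is a TAF-domain if every proper ideal of $R$ is a finite product of 2-absorbing ideals. $R$ is Mori if it satisfies the ascending chain condition on divisorial ideals, i.e. on the nonzero ideals $I$ of $R$ with $R:(R:I)=I$. A ring extension $A\subseteq B$ is unibranched if for each prime ideal $P$ of $A$ there is exactly one prime ideal $Q$ of $B$ with $Q\cap A=P$. A Prüfer domain is an integral domain all of whose localizations at maximal ideals are valuation domains. $R$ is a GPVD (globalized pseudo-valuation domain) if there is a Prüfer domain $T$ with $R\subseteq T\subseteq K$ such that $R\subseteq T$ is unibranched and there is a nonzero common ideal $A$ of $R$ and $T$, radical in both (possibly $A=R=T$), such that every prime ideal of $T$ (respectively, of $R$) containing $A$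 is a maximal ideal of $T$ (respectively, of $R$). Theorem. The following are equivalent: 1. $R$ is a TAF-domain and $R:R^{*}\neq(0)$. 2. $R$ is a Mori GPVD. 3. There exist a Dedekind domain $T$, an integer $n\ge 1$, distinct maximal ideals $N_{1},\dots,N_{n}$ of $T$ and subfields $K_{i}\subseteq T/N_{i}$ ($1\le i\le n$, equality $K_i=T/N_i$ being allowed) such that, up to isomorphism, $R$ is the subring $\pi^{-1}\left(\prod_{i=1}^{n}K_{i}\right)$ of $T$, where $\pi:T\to\prod_{i=1}^{n}(T/N_{i})$ is the canonical map. 4. $R^{*}$ is a Dedekind domain and $R/(R:R^{*})\subseteq R^{*}/(R:R^{*})$ is a unibranched extension of Artinian reduced rings (if $R=R^{*}$, both quotients are the zero ring, which is allowed here and counts as Artinian and reduced). -/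

import Mathlib

universe u v


/-! ### Two-absorbing ideals and TAF-rings -/

/-- An ideal `I` is 2-absorbing if `a * b * c ∈ I` forces one of the three pairwise products
into `I`. -/
def IsTwoAbsorbing {R : Type*} [CommRing R] (I : Ideal R) : Prop :=
  ∀ a b c : R, a * b * c ∈ I → a * b ∈ I ∨ a * c ∈ I ∨ b * c ∈ I

/-- A TAF-ring: every proper ideal is a finite product of 2-absorbing ideals. A TAF-domain is a
TAF-ring that is an integral domain. -/
def IsTAFRing (R : Type*) [CommRing R] : Prop :=
  ∀ I : Ideal R, I ≠ ⊤ →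
    ∃ s : Multiset (Ideal R), (∀ J ∈ s, IsTwoAbsorbing J) ∧ s.prod = I

/-! ### Divisorial ideals and Mori domains

In the following `K` is a quotient field of the domain `R`. For `R`-submodules `I`, `J` of `K`,
Mathlib's `I / J` is the colon `{x ∈ K | x J ⊆ I}`, and `1 : Submodule R K` is the image of `R`. -/

/-- A divisorial ideal of `R`: a nonzero ideal `I` with `R : (R : I) = I` inside `K`. -/
def IsDivisorialIdeal (R K : Type*) [CommRing R] [Field K] [Algebra R K] (I : Ideal R) : Prop :=
  I ≠ ⊥ ∧
    (1 : Submodule R K) / (1 / IsLocalization.coeSubmodule K I) = IsLocalization.coeSubmodule K I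

/-- A Mori domain: the ascending chain condition on divisorial ideals. -/
def IsMoriDomain (R K : Type*) [CommRing R] [Field K] [Algebra R K] : Prop :=
  ∀ f : ℕ → Ideal R, Monotone f → (∀ n, IsDivisorialIdeal R K (f n)) →
    ∃ n, ∀ m, n ≤ m → f m = f n

/-! ### Unibranched extensions, Prüfer domains and GPVDs -/

/-- A ring extension `f : A ↪ B` is unibranched if every prime ideal of `A` is the contraction of
exactly one prime ideal of `B`. -/
def IsUnibranched {A B : Type*} [CommRing A] [CommRing B] (f : A →+* B) : Prop :=
  Function.Injective f ∧
    ∀ P : Ideal A, P.IsPrime → ∃! Q : Ideal B, Q.IsPrime ∧ Q.comap f = P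

/-- A Prüfer domain: all localizations at maximal ideals are valuation domains. -/
def IsPruferDomain (T : Type*) [CommRing T] [IsDomain T] : Prop :=
  ∀ (M : Ideal T) [M.IsMaximal], ValuationRing (Localization.AtPrime M)

/-- A globalized pseudo-valuation domain. The overrings of `R` are the `R`-subalgebras of the
quotient field `K`; the ideals `A` of `R` and `B` of `T` are the same subset of `K`. -/
def IsGPVD (R K : Type*) [CommRing R] [Field K] [Algebra R K] : Prop :=
  ∃ T : Subalgebra R K, IsPruferDomain T ∧ IsUnibranched (algebraMap R T) ∧
    ∃ (A : Ideal R) (B : Ideal T),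
      (algebraMap R T) '' (A : Set R) = (B : Set T) ∧
      A ≠ ⊥ ∧ A.IsRadical ∧ B.IsRadical ∧
      (∀ P : Ideal R, P.IsPrime → A ≤ P → P.IsMaximal) ∧
      (∀ Q : Ideal T, Q.IsPrime → B ≤ Q → Q.IsMaximal)

/-! ### The conductor of an overring -/

section Conductor

variable {R K : Type*} [CommRing R] [Field K] [Algebra R K]

/-- The conductor `R : T = {x ∈ K | x T ⊆ R}` of an overring `T`, as an `R`-submodule of `K`. -/
def overringConductor (T : Subalgebra R K) : Submodule R K :=
  1 / Subalgebra.toSubmodule T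

theorem mem_overringConductor {T : Subalgebra R K} {x : K} :
    x ∈ overringConductor T ↔ ∀ t ∈ T, ∃ r : R, algebraMap R K r = x * t := by
  simp [overringConductor, Submodule.mem_div_iff_forall_mul_mem, Submodule.mem_one]

/-- The conductor `R : T` as an ideal of `R`. -/
def conductorBelow (T : Subalgebra R K) : Ideal R :=
  (overringConductor T).comap (Algebra.linearMap R K)

/-- The conductor `R : T` as an ideal of `T`. -/
def conductorAbove (T : Subalgebra R K) : Ideal T where
  carrier := {t | (t : K) ∈ overringConductor T}
  add_mem' := fun ha hb => (overringConductor T).add_mem ha hb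
  zero_mem' := (overringConductor T).zero_mem
  smul_mem' := fun c x hx => mem_overringConductor.2 fun t ht => by
    obtain ⟨r, hr⟩ := mem_overringConductor.1 hx (c * t) (T.mul_mem c.2 ht)
    exact ⟨r, by rw [hr, smul_eq_mul, MulMemClass.coe_mul]; ring⟩

theorem conductorBelow_le_comap (T : Subalgebra R K) :
    conductorBelow T ≤ (conductorAbove T).comap (algebraMap R T) :=
  fun _ hx => hx

/-- The canonical map `R / (R : T) → T / (R : T)`. -/
def conductorQuotientMap (T : Subalgebra R K) :
    R ⧸ conductorBelow T →+* T ⧸ conductorAbove T :=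
  Ideal.quotientMap (conductorAbove T) (algebraMap R T) (conductorBelow_le_comap T)

end Conductor

/-! ### Pullbacks -/

/-- For subrings `k i` of `T / N i`, the subring `π⁻¹(∏ k i)` of `T`, where
`π : T → ∏ T / N i` is the canonical map. -/
def pullbackSubring {T : Type*} [CommRing T] {n : ℕ} (N : Fin n → Ideal T)
    (k : ∀ i, Subring (T ⧸ N i)) : Subring T where
  carrier := (RingHom.pi fun i => Ideal.Quotient.mk (N i)) ⁻¹'
    Set.univ.pi fun i => (k i : Set (T ⧸ N i))
  mul_mem' := fun ha hb i hi => by simpa using (k i).mul_mem (ha i hi) (hb i hi)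
  one_mem' := fun i _ => by simp
  add_mem' := fun ha hb i hi => by simpa using (k i).add_mem (ha i hi) (hb i hi)
  zero_mem' := fun i _ => by simp
  neg_mem' := fun ha i hi => by simpa using (k i).neg_mem (ha i hi)

theorem mem_pullbackSubring {T : Type*} [CommRing T] {n : ℕ} {N : Fin n → Ideal T}
    {k : ∀ i, Subring (T ⧸ N i)} {t : T} :
    t ∈ pullbackSubring N k ↔ ∀ i, Ideal.Quotient.mk (N i) t ∈ k i :=
  ⟨fun h i => h i trivial, fun h i _ => h i⟩

/-! ### Two-absorbing ideals -/

namespace IsTwoAbsorbing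

variable {R : Type*} [CommRing R] {J : Ideal R}

/-! All four conditions are compared with one relation, `IsPseudoDedekind R T` with `T` Dedekind:
the conductor `C = R : T` is nonzero, nonzero primes `Q` of `T` contract to maximal ideals of `R`,
and some `s ∈ R \ Q` satisfies `sQ ⊆ R`. Then `T` must be `R*`
(`nonempty_algEquiv_completeIntegralClosure`), and `C` is radical (`isRadical_algebraConductor`).

From TAF to the relation: in a local TAF-ring a proper ideal not inside `m²` is 2-absorbing, hence
contains the square of its radical. This forces dimension at most one (`dimensionLEOne`) and makes
`m : m` a discrete valuation ring whose uniformizers include elements of `m \ m²`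
(`exists_isUniformizer`). A nonzero 2-absorbing ideal lies in at most two maximal ideals, so `R` has
finite character. Hence `R*`, the intersection of these valuation rings, is Dedekind, and a nonzero
conductor supplies the separators `s`.

Back to TAF: `Q² = xQ + Q³` descends to `M² ⊆ xM + M³` for `x ∈ M \ M²`. Ideals split into comaximal
pieces containing powers of maximal ideals, and such a piece is factored by dividing by `x`.

Mori GPVDs: a chain of divisorial ideals stabilizes after extension to `T`, and from then on the
duals are controlled by the Artinian ring `R/(C ∩ R)`. Conversely, for a Prüfer overring `T`, `J ↦
CJ` sends nonzero finitely generated ideals to divisorial ideals of `R`, and `C : C = T` allows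
cancelling `C`; so `T` is Noetherian.

Conditions 2, 3 and 4 yield the relation through `of_isRadical`: a nonzero radical ideal of `T`
inside `R` suffices, if the primes over it have distinct maximal contractions. -/

theorem sq_mem_of_pow_mem (hJ : IsTwoAbsorbing J) {a : R} {n : ℕ} (h : a ^ n ∈ J) : a ^ 2 ∈ J := by
  induction n with
  | zero => rw [(Ideal.eq_top_iff_one J).2 (by simpa using h)]; trivial
  | succ n ih =>
    match n, ih, h with
    | 0, _, h => rw [pow_two]; exact J.mul_mem_left _ (by simpa using h)
    | 1, _, h => exact h
    | n + 2, ih, h =>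
      have : a ^ (n + 1) * a * a ∈ J := by convert h using 1; ring
      rcases hJ _ _ _ this with h | h | h
      · exact ih (by convert h using 1; ring)
      · exact ih (by convert h using 1; ring)
      · rwa [pow_two]

theorem mul_mem_of_sq_mem (hJ : IsTwoAbsorbing J) {a b : R} (ha : a ^ 2 ∈ J) (hb : b ^ 2 ∈ J) :
    a * b ∈ J := by
  -- For the triple `a, b, a + b` the other two outcomes differ from `ab` by a square already in
  -- `J`.
  have : a * b * (a + b) ∈ J := by
    have : a * b * (a + b) = b * a ^ 2 + a * b ^ 2 := by ring
    rw [this]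
    exact J.add_mem (J.mul_mem_left _ ha) (J.mul_mem_left _ hb)
  rcases hJ _ _ _ this with h | h | h
  · exact h
  · rw [mul_add, ← pow_two] at h
    exact (J.add_mem_iff_right ha).1 h
  · rw [mul_add, ← pow_two, mul_comm b a] at h
    exact (J.add_mem_iff_left hb).1 h

theorem pow_two_le (hJ : IsTwoAbsorbing J) {M : Ideal R} (hM : M ≤ J.radical) : M ^ 2 ≤ J := by
  rw [pow_two, Ideal.mul_le]
  intro a ha b hb
  obtain ⟨n, hn⟩ := hM ha
  obtain ⟨k, hk⟩ := hM hb
  exact hJ.mul_mem_of_sq_mem (hJ.sq_mem_of_pow_mem hn) (hJ.sq_mem_of_pow_mem hk)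

theorem map_of_isLocalization (hJ : IsTwoAbsorbing J) (S : Submonoid R) (L : Type*) [CommRing L]
    [Algebra R L] [IsLocalization S L] : IsTwoAbsorbing (J.map (algebraMap R L)) := by
  have key : ∀ (x : L) (s : S) (r : R), x * algebraMap R L s = algebraMap R L r → r ∈ J →
      x ∈ J.map (algebraMap R L) := by
    intro x s r h hr
    rw [← Ideal.mul_unit_mem_iff_mem _ (IsLocalization.map_units L s), h]
    exact Ideal.mem_map_of_mem _ hr
  intro x y z h
  obtain ⟨⟨a, s⟩, ha⟩ := IsLocalization.surj S x
  obtain ⟨⟨b, t⟩, hb⟩ := IsLocalization.surj S y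
  obtain ⟨⟨c, w⟩, hc⟩ := IsLocalization.surj S z
  dsimp only at ha hb hc
  have h2 : algebraMap R L (a * b * c) ∈ J.map (algebraMap R L) := by
    have : algebraMap R L (a * b * c) =
        algebraMap R L s * algebraMap R L t * algebraMap R L w * (x * y * z) := by
      rw [map_mul, map_mul, ← ha, ← hb, ← hc]; ring
    rw [this]
    exact Ideal.mul_mem_left _ _ h
  rw [IsLocalization.algebraMap_mem_map_algebraMap_iff S] at h2
  obtain ⟨m, hm, h2⟩ := h2
  -- Absorbing `m` into the first factor keeps three factors; it becomes a unit in `L` in either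
  -- outcome where it survives.
  have h3 : m * a * b * c ∈ J := by convert h2 using 1; ring
  rcases hJ _ _ _ h3 with h | h | h
  · refine Or.inl (key _ (⟨m, hm⟩ * s * t) _ ?_ h)
    simp only [Submonoid.coe_mul, map_mul, ← ha, ← hb]; ring
  · refine Or.inr (Or.inl (key _ (⟨m, hm⟩ * s * w) _ ?_ h))
    simp only [Submonoid.coe_mul, map_mul, ← ha, ← hc]; ring
  · refine Or.inr (Or.inr (key _ (t * w) _ ?_ h))
    simp only [Submonoid.coe_mul, map_mul, ← hb, ← hc]; ring

end IsTwoAbsorbing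

/-! ### TAF-rings and their dimension -/

namespace IsTAFRing

theorem of_isLocalization {R : Type*} [CommRing R] (h : IsTAFRing R) (S : Submonoid R) (L : Type*)
    [CommRing L] [Algebra R L] [IsLocalization S L] : IsTAFRing L := by
  intro I hI
  obtain ⟨s, hs, hp⟩ := h (I.comap (algebraMap R L)) (Ideal.comap_ne_top _ hI)
  refine ⟨s.map (Ideal.map (algebraMap R L)), ?_, ?_⟩
  · simp only [Multiset.mem_map, forall_exists_index, and_imp, forall_apply_eq_imp_iff₂]
    exact fun J hJ => (hs J hJ).map_of_isLocalization S L
  · have := map_multiset_prod (Ideal.mapHom (algebraMap R L)) s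
    rw [hp] at this
    simp only [Ideal.mapHom_apply] at this
    rw [IsLocalization.map_under S L I] at this
    exact this.symm

variable {L : Type*} [CommRing L]

theorem exists_proper_factors (h : IsTAFRing L) {I : Ideal L} (hI : I ≠ ⊤) :
    ∃ s : Multiset (Ideal L), (∀ J ∈ s, IsTwoAbsorbing J ∧ J ≠ ⊤ ∧ I ≤ J) ∧ s.prod = I := by
  classical
  obtain ⟨s, hs, rfl⟩ := h I hI
  refine ⟨s.filter (· ≠ ⊤), fun J hJ => ?_, ?_⟩
  · rw [Multiset.mem_filter] at hJ
    exact ⟨hs J hJ.1, hJ.2, Ideal.le_of_dvd (Multiset.dvd_prod hJ.1)⟩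
  · clear hs hI
    induction s using Multiset.induction_on with
    | empty => simp
    | cons J s ih =>
      by_cases hJ : J = ⊤
      · rw [Multiset.filter_cons_of_neg _ (by simpa using hJ), ih, Multiset.prod_cons, hJ,
          Ideal.top_mul]
      · rw [Multiset.filter_cons_of_pos _ (by simpa using hJ), Multiset.prod_cons, ih,
          Multiset.prod_cons]

variable [IsLocalRing L]

open IsLocalRing

/-- Two proper factors already force the product into `m²`, and a single factor is the ideal itself.
-/
theorem isTwoAbsorbing_or_le_sq (h : IsTAFRing L) {I : Ideal L} (hI : I ≠ ⊤) :
    IsTwoAbsorbing I ∨ I ≤ maximalIdeal L ^ 2 := by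
  obtain ⟨s, hs, rfl⟩ := h.exists_proper_factors hI
  induction s using Multiset.induction_on with
  | empty => simp at hI
  | cons J s ih =>
    induction s using Multiset.induction_on with
    | empty => left; simpa using (hs J (by simp)).1
    | cons J' s ih' =>
      right
      rw [Multiset.prod_cons, Multiset.prod_cons, pow_two]
      exact Ideal.mul_mono (le_maximalIdeal (hs J (by simp)).2.1)
        (Ideal.mul_le_left.trans (le_maximalIdeal (hs J' (by simp)).2.1) : J' * s.prod ≤ _)

theorem exists_pow_le (h : IsTAFRing L) {I : Ideal L} (hI : maximalIdeal L ≤ I.radical) :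
    ∃ k, maximalIdeal L ^ (2 * k) ≤ I := by
  by_cases hI' : I = ⊤
  · exact ⟨0, hI' ▸ le_top⟩
  obtain ⟨s, hs, rfl⟩ := h.exists_proper_factors hI'
  refine ⟨s.card, ?_⟩
  replace hs : ∀ J ∈ s, maximalIdeal L ^ 2 ≤ J := fun J hJ =>
    (hs J hJ).1.pow_two_le (hI.trans (Ideal.radical_mono (hs J hJ).2.2))
  clear hI hI'
  rw [pow_mul]
  induction s using Multiset.induction_on with
  | empty => simp
  | cons J s ih =>
    rw [Multiset.card_cons, pow_succ', Multiset.prod_cons]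
    exact Ideal.mul_mono (hs J (by simp)) (ih fun K hK => hs K (Multiset.mem_cons_of_mem hK))

theorem eq_of_maximalIdeal_le_radical (h : IsTAFRing L) (hm : maximalIdeal L ^ 2 = maximalIdeal L)
    {I : Ideal L} (hI : maximalIdeal L ≤ I.radical) : maximalIdeal L ≤ I := by
  obtain ⟨k, hk⟩ := h.exists_pow_le hI
  rw [pow_mul, hm] at hk
  refine le_trans ?_ hk
  have : ∀ n, maximalIdeal L ≤ maximalIdeal L ^ n := by
    intro n
    induction n with
    | zero => simp
    | succ n ih => rw [pow_succ]; nth_rw 1 [← hm, pow_two]; exact Ideal.mul_mono_left ih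
  exact this k

theorem _root_.IsLocalRing.le_radical_of_forall_isPrime {I : Ideal L}
    (h : ∀ Q : Ideal L, Q.IsPrime → I ≤ Q → Q = maximalIdeal L) : maximalIdeal L ≤ I.radical := by
  rw [Ideal.radical_eq_sInf]
  exact le_sInf fun Q hQ => (h Q hQ.2 hQ.1).ge

/-- In a local ring, `x = a + r * (y * x)` with `y` a nonunit forces `x` to be a multiple of `a`. -/
theorem _root_.IsLocalRing.mem_of_mul_one_sub_mem {I : Ideal L} {x y : L}
    (hy : y ∈ maximalIdeal L) (h : x - y * x ∈ I) : x ∈ I := by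
  have h1 : IsUnit (1 - y) := IsLocalRing.isUnit_one_sub_self_of_mem_nonunits y hy
  rw [← Ideal.mul_unit_mem_iff_mem I h1]
  convert h using 1; ring

/-- The core of the dimension bound. A nonzero prime `P` directly below `m` would lie in `m²`, hence
in `(x)` for a suitable `x ∈ m \ m²`, so that `P = xP`. The 2-absorbing property passes this
divisibility to a factor of a principal ideal `(y) ⊆ P`, giving `(y) = x(y)` with `x` a nonunit. -/
theorem false_of_isMinimal_prime_pair [IsDomain L] (h : IsTAFRing L) {P₀ : Ideal L}
    (hP₀ : P₀ ≠ ⊥) [P₀.IsPrime] {z : L} (hz : z ∈ maximalIdeal L) (hzP₀ : z ∉ P₀)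
    (hmin : ∀ Q : Ideal L, Q.IsPrime → P₀ ≤ Q → z ∈ Q → Q = maximalIdeal L) : False := by
  -- `P₀` is enlarged to a prime `P` maximal among ideals avoiding the powers of `z`; no prime then
  -- lies strictly between `P` and `m`.
  obtain ⟨P, hP₀P, hP⟩ := zorn_le_nonempty₀
    {I : Ideal L | Disjoint (I : Set L) (Submonoid.powers z)}
    (fun c hc hcc J hJ => ⟨sSup c, by
      simp only [Set.mem_ofPred_eq, Set.disjoint_left, SetLike.mem_coe]
      intro a ha
      rw [Submodule.mem_sSup_of_directed ⟨J, hJ⟩ hcc.directedOn] at ha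
      obtain ⟨I, hI, haI⟩ := ha
      exact Set.disjoint_left.1 (hc hI) haI, fun I hI => le_sSup hI⟩) P₀ (by
      simp only [Set.mem_ofPred_eq, Set.disjoint_right, SetLike.mem_coe]
      rintro _ ⟨n, rfl⟩ hn
      exact hzP₀ (Ideal.IsPrime.mem_of_pow_mem ‹_› n hn))
  have hPprime : P.IsPrime :=
    Ideal.isPrime_of_maximally_disjoint P _ hP.prop fun J hJ => hP.not_prop_of_gt hJ
  have hzP : z ∉ P := fun hzP => Set.disjoint_left.1 hP.prop hzP ⟨1, pow_one z⟩
  have hadj : ∀ x : L, x ∉ P → ∀ I : Ideal L, P ≤ I.radical → x ∈ I →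
      maximalIdeal L ≤ I.radical := by
    intro x hx I hPI hxI
    refine le_radical_of_forall_isPrime fun Q hQ hIQ => ?_
    have hPQ : P ≤ Q := hPI.trans ((Ideal.IsPrime.radical_le_iff hQ).2 hIQ)
    refine hmin Q hQ (hP₀P.trans hPQ) ?_
    by_contra hzQ
    have : Disjoint (Q : Set L) (Submonoid.powers z) := by
      rw [Set.disjoint_right]
      rintro _ ⟨n, rfl⟩ hn
      exact hzQ (hQ.mem_of_pow_mem n hn)
    exact hx (hP.le_of_ge this hPQ (hIQ hxI))
  have hm : P ≤ maximalIdeal L := le_maximalIdeal hPprime.ne_top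
  have hnot : ∀ k, z ^ k ∈ P ⊔ Ideal.span {z ^ (k + 1)} → False := by
    intro k hk
    obtain ⟨c, p, hp, hcp⟩ := Ideal.mem_span_singleton_sup.1 (sup_comm P _ ▸ hk)
    have : z ^ k ∈ P := by
      refine mem_of_mul_one_sub_mem (y := c * z) (Ideal.mul_mem_left _ _ hz) ?_
      convert hp using 1
      linear_combination -hcp
    exact hzP (hPprime.mem_of_pow_mem _ this)
  have hsup : ∀ k, maximalIdeal L ≤ (P ⊔ Ideal.span {z ^ k}).radical := fun k =>
    hadj (z ^ k) (fun h => hzP (hPprime.mem_of_pow_mem _ h)) _ (le_sup_left.trans Ideal.le_radical)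
      (Ideal.mem_sup_right (Ideal.mem_span_singleton_self _))
  have hPsq : P ≤ maximalIdeal L ^ 2 := by
    have hne : P ⊔ Ideal.span {z ^ 3} ≠ ⊤ := ne_top_of_le_ne_top (Ideal.IsMaximal.ne_top
      (IsLocalRing.maximalIdeal.isMaximal L)) (sup_le hm (by
        rw [Ideal.span_singleton_le_iff_mem]; exact Ideal.pow_mem_of_mem _ hz _ (by simp)))
    rcases h.isTwoAbsorbing_or_le_sq hne with h2 | h2
    · exact (hnot 2 (h2.pow_two_le (hsup 3) (Ideal.pow_mem_pow hz 2))).elim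
    · exact le_sup_left.trans h2
  -- If `m = m²`, then `P + (z²)`, whose radical contains `m`, would contain `m` and hence `z`,
  -- against `hnot`.
  obtain ⟨x, hx, hx2⟩ : ∃ x ∈ maximalIdeal L, x ∉ maximalIdeal L ^ 2 := by
    by_contra! hcon
    refine hnot 1 ?_
    rw [pow_one]
    exact h.eq_of_maximalIdeal_le_radical (le_antisymm (Ideal.pow_le_self two_ne_zero) hcon)
      (hsup 2) hz
  have hxP : x ∉ P := fun h => hx2 (hPsq h)
  have habs : ∀ I : Ideal L, I ≤ maximalIdeal L → x ∈ I → IsTwoAbsorbing I := by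
    intro I hI hxI
    exact (h.isTwoAbsorbing_or_le_sq (ne_top_of_le_ne_top (Ideal.IsMaximal.ne_top
      (IsLocalRing.maximalIdeal.isMaximal L)) hI)).resolve_right fun h => hx2 (h hxI)
  have hspan : ∀ a ∈ maximalIdeal L, Ideal.span {a} ≤ maximalIdeal L := fun a ha => by
    rwa [Ideal.span_singleton_le_iff_mem]
  -- For `w ∈ P` the ideal `(w³, x)` contains `x`, so it is 2-absorbing and contains `w²`; since `1
  -- - cw` is a unit, `w² ∈ (x)`.
  have hPrad : P ≤ (Ideal.span {x}).radical := by
    intro w hw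
    have hw3 : w ^ 3 ∈ maximalIdeal L := Ideal.pow_mem_of_mem _ (hm hw) _ (by simp)
    have h2 : w ^ 2 ∈ Ideal.span {w ^ 3} ⊔ Ideal.span {x} :=
      (habs _ (sup_le (hspan _ hw3) (hspan x hx))
        (Ideal.mem_sup_right (Ideal.mem_span_singleton_self x))).sq_mem_of_pow_mem
        (Ideal.mem_sup_left (Ideal.mem_span_singleton_self (w ^ 3)))
    obtain ⟨c, p, hp, hcp⟩ := Ideal.mem_span_singleton_sup.1 h2
    refine ⟨2, mem_of_mul_one_sub_mem (y := c * w) (Ideal.mul_mem_left _ _ (hm hw)) ?_⟩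
    convert hp using 1
    linear_combination -hcp
  have hmx : maximalIdeal L ^ 2 ≤ Ideal.span {x} :=
    (habs _ (hspan x hx) (Ideal.mem_span_singleton_self x)).pow_two_le
      (hadj x hxP _ hPrad (Ideal.mem_span_singleton_self x))
  have hdiv : ∀ p ∈ P, ∃ q ∈ P, p = x * q := by
    intro p hp
    obtain ⟨q, rfl⟩ := Ideal.mem_span_singleton.1 (hmx (hPsq hp))
    exact ⟨q, (hPprime.mem_or_mem hp).resolve_left hxP, rfl⟩
  obtain ⟨y, hyP, hy0⟩ := Submodule.exists_mem_ne_zero_of_ne_bot (ne_bot_of_le_ne_bot hP₀ hP₀P)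
  obtain ⟨s, hs, hprod⟩ := h.exists_proper_factors (ne_top_of_le_ne_top (Ideal.IsMaximal.ne_top
      (IsLocalRing.maximalIdeal.isMaximal L)) (hspan y (hm hyP)))
  obtain ⟨J, hJs, hJP⟩ := (Ideal.IsPrime.multiset_prod_le hPprime).1
    (hprod.trans_le (by rwa [Ideal.span_singleton_le_iff_mem]))
  obtain ⟨t, rfl⟩ := Multiset.exists_cons_of_mem hJs
  -- Write `j = x · x · q` with `q ∈ P`. Since `x² ∉ P`, the 2-absorbing property leaves `xq ∈ J`,
  -- whence `j ∈ xJ`.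
  have hJx : J ≤ Ideal.span {x} * J := by
    intro j hj
    obtain ⟨p, hp, rfl⟩ := hdiv j (hJP hj)
    obtain ⟨q, hq, rfl⟩ := hdiv p hp
    refine Ideal.mul_mem_mul (Ideal.mem_span_singleton_self x) ?_
    rcases (hs J hJs).1 x x q (by rwa [mul_assoc]) with h | h | h
    · exact (hxP ((hPprime.mem_or_mem (hJP h)).elim id id)).elim
    · exact h
    · exact h
  have hyx : Ideal.span {y} ≤ Ideal.span {x} * Ideal.span {y} := by
    rw [← hprod, Multiset.prod_cons, ← mul_assoc]
    exact Ideal.mul_mono_left hJx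
  rw [Ideal.span_singleton_mul_span_singleton, Ideal.span_singleton_le_span_singleton] at hyx
  obtain ⟨c, hc⟩ := hyx
  refine hx ?_
  have : y * 1 = y * (x * c) := by linear_combination hc
  exact IsUnit.of_mul_eq_one c (mul_left_cancel₀ hy0 this).symm

variable {R : Type*} [CommRing R] [IsDomain R]

/-- For a nonzero nonmaximal prime `P` and `z ∉ P` in a maximal ideal above it, localizing at a
minimal prime of `P + (z)` gives the configuration excluded above. -/
theorem dimensionLEOne (h : IsTAFRing R) : Ring.DimensionLEOne R := by
  constructor
  intro P hP hPprime
  by_contra hPmax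
  obtain ⟨M₀, hM₀, hPM₀⟩ := Ideal.exists_le_maximal P hPprime.ne_top
  obtain ⟨z, hzM₀, hzP⟩ := SetLike.exists_of_lt
    (lt_of_le_of_ne hPM₀ fun h => hPmax (h ▸ hM₀))
  have hle : P ⊔ Ideal.span {z} ≤ M₀ :=
    sup_le hPM₀ (by rwa [Ideal.span_singleton_le_iff_mem])
  have := hM₀.isPrime
  obtain ⟨M, hM, -⟩ := Ideal.exists_minimalPrimes_le hle
  have hMprime : M.IsPrime := hM.1.1
  have hPM : P ≤ M := le_sup_left.trans hM.1.2
  have hzM : z ∈ M := hM.1.2 (Ideal.mem_sup_right (Ideal.mem_span_singleton_self z))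
  let L := Localization.AtPrime M
  have hdisj : Disjoint (M.primeCompl : Set R) (P : Set R) := by
    rw [Set.disjoint_left]
    exact fun a ha ha' => ha (hPM ha')
  have hcomap := IsLocalization.under_map_of_isPrime_disjoint M.primeCompl L hPprime hdisj
  have hPL : (P.map (algebraMap R L)).IsPrime :=
    IsLocalization.isPrime_of_isPrime_disjoint M.primeCompl L P hPprime hdisj
  refine (h.of_isLocalization M.primeCompl L).false_of_isMinimal_prime_pair
    (P₀ := P.map (algebraMap R L)) (z := algebraMap R L z) ?_ ?_ ?_ ?_
  · intro hbot
    rw [Ideal.map_eq_bot_iff_of_injective (IsLocalization.injective L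
      M.primeCompl_le_nonZeroDivisors)] at hbot
    exact hP hbot
  · rw [← Localization.AtPrime.map_eq_maximalIdeal]
    exact Ideal.mem_map_of_mem _ hzM
  · intro hz
    refine hzP ?_
    rw [← hcomap]
    exact hz
  · intro Q hQ hPQ hzQ
    rw [← Localization.AtPrime.map_eq_maximalIdeal, ← IsLocalization.map_under M.primeCompl L Q]
    congr 1
    have hQM : Q.under R ≤ M := by
      intro a ha
      by_contra haM
      exact hQ.ne_top (Ideal.eq_top_of_isUnit_mem _ ha
        (IsLocalization.map_units L (⟨a, haM⟩ : M.primeCompl)))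
    refine le_antisymm hQM (hM.2 ⟨Ideal.IsPrime.under R Q, sup_le ?_ ?_⟩ hQM)
    · exact Ideal.map_le_iff_le_comap.1 hPQ
    · rw [Ideal.span_singleton_le_iff_mem]
      exact hzQ

end IsTAFRing

/-! ### The ring of multipliers of an ideal -/

/-- The ring `I : I` of the elements of `K` that map the ideal `I` into itself. -/
def Ideal.multiplierRing {L : Type*} (K : Type*) [CommRing L] [Field K] [Algebra L K]
    (I : Ideal L) : Subring K where
  carrier := {u | ∀ a ∈ I, ∃ b ∈ I, u * algebraMap L K a = algebraMap L K b}
  mul_mem' := by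
    intro u v hu hv a ha
    obtain ⟨b, hb, hab⟩ := hv a ha
    obtain ⟨c, hc, hbc⟩ := hu b hb
    exact ⟨c, hc, by rw [mul_assoc, hab, hbc]⟩
  one_mem' := fun a ha => ⟨a, ha, one_mul _⟩
  add_mem' := by
    intro u v hu hv a ha
    obtain ⟨b, hb, hab⟩ := hu a ha
    obtain ⟨c, hc, hac⟩ := hv a ha
    exact ⟨b + c, I.add_mem hb hc, by rw [add_mul, hab, hac, map_add]⟩
  zero_mem' := fun a ha => ⟨0, I.zero_mem, by simp⟩
  neg_mem' := by
    intro u hu a ha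
    obtain ⟨b, hb, hab⟩ := hu a ha
    exact ⟨-b, I.neg_mem hb, by rw [neg_mul, hab, map_neg]⟩

theorem Ideal.algebraMap_mem_multiplierRing {L K : Type*} [CommRing L] [Field K] [Algebra L K]
    (I : Ideal L) (r : L) : algebraMap L K r ∈ I.multiplierRing K :=
  fun a ha => ⟨r * a, I.mul_mem_left _ ha, (map_mul _ _ _).symm⟩

/-! ### Subrings with a uniformizer -/

/-- `x` is a uniformizer of the subring `V` of `K`: it is a nonunit of `V`, and the nonzero elements
of `K` are powers of `x` times units of `V`. -/
structure Subring.IsUniformizer {K : Type*} [Field K] (V : Subring K) (x : K) : Prop where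
  mem : x ∈ V
  ne_zero : x ≠ 0
  inv_notMem : x⁻¹ ∉ V
  exists_eq : ∀ y : K, y ≠ 0 → ∃ (n : ℤ) (u : K), u ∈ V ∧ u⁻¹ ∈ V ∧ y = x ^ n * u

namespace Subring.IsUniformizer

variable {K : Type*} [Field K] {V : Subring K} {x : K}

theorem zpow_mem (h : V.IsUniformizer x) {n : ℤ} (hn : 0 ≤ n) : x ^ n ∈ V := by
  obtain ⟨k, rfl⟩ := Int.eq_ofNat_of_zero_le hn
  rw [zpow_natCast]
  exact V.pow_mem h.mem k

theorem nonneg_of_mem (h : V.IsUniformizer x) {n : ℤ} {u : K} (hu : u ≠ 0) (hu' : u⁻¹ ∈ V)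
    (hn : x ^ n * u ∈ V) : 0 ≤ n := by
  by_contra! hneg
  have h1 := V.mul_mem (V.mul_mem hn hu') (h.zpow_mem (n := -n - 1) (by omega))
  rw [mul_assoc (x ^ n), mul_inv_cancel₀ hu, mul_one, ← zpow_add₀ h.ne_zero] at h1
  have : n + (-n - 1) = -1 := by ring
  rw [this, zpow_neg_one] at h1
  exact h.inv_notMem h1

theorem exists_dvd (h : V.IsUniformizer x) {I : Set K} (hI : I ⊆ V) (hI0 : ∃ a ∈ I, a ≠ 0) :
    ∃ a ∈ I, a ≠ 0 ∧ ∀ b ∈ I, b / a ∈ V := by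
  classical
  have hex : ∃ n : ℕ, ∃ u ∈ V, u⁻¹ ∈ V ∧ x ^ n * u ∈ I ∧ u ≠ 0 := by
    obtain ⟨a, haI, ha0⟩ := hI0
    obtain ⟨n, u, hu, hu', rfl⟩ := h.exists_eq a ha0
    have hu0 : u ≠ 0 := right_ne_zero_of_mul ha0
    obtain ⟨k, rfl⟩ := Int.eq_ofNat_of_zero_le (h.nonneg_of_mem hu0 hu' (hI haI))
    exact ⟨k, u, hu, hu', by simpa using haI, hu0⟩
  obtain ⟨u, hu, hu', huI, hu0⟩ := Nat.find_spec hex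
  refine ⟨_, huI, mul_ne_zero (pow_ne_zero _ h.ne_zero) hu0, fun b hb => ?_⟩
  by_cases hb0 : b = 0
  · simp [hb0]
  obtain ⟨n, w, hw, hw', rfl⟩ := h.exists_eq b hb0
  have hw0 : w ≠ 0 := right_ne_zero_of_mul hb0
  obtain ⟨k, rfl⟩ := Int.eq_ofNat_of_zero_le (h.nonneg_of_mem hw0 hw' (hI hb))
  have hle : Nat.find hex ≤ k := Nat.find_min' hex ⟨w, hw, hw', by simpa using hb, hw0⟩
  obtain ⟨d, hd⟩ := Nat.exists_eq_add_of_le hle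
  have : x ^ (k : ℤ) * w / (x ^ Nat.find hex * u) = x ^ d * (w * u⁻¹) := by
    rw [zpow_natCast, hd, pow_add]
    field_simp [h.ne_zero]
  rw [this]
  exact V.mul_mem (V.pow_mem h.mem d) (V.mul_mem hw hu')

/-- A discrete valuation ring is completely integrally closed: a negative value of `y` would
eventually outweigh the value of `r`. -/
theorem mem_of_forall_mul_pow_mem (h : V.IsUniformizer x) {r y : K} (hr : r ≠ 0)
    (hy : ∀ n : ℕ, r * y ^ n ∈ V) : y ∈ V := by
  by_cases hy0 : y = 0
  · rw [hy0]; exact V.zero_mem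
  obtain ⟨k, w, hw, hw', rfl⟩ := h.exists_eq r hr
  obtain ⟨n, u, hu, hu', rfl⟩ := h.exists_eq y hy0
  have hu0 : u ≠ 0 := right_ne_zero_of_mul hy0
  have hw0 : w ≠ 0 := right_ne_zero_of_mul hr
  suffices 0 ≤ n from V.mul_mem (h.zpow_mem this) hu
  by_contra! hn
  -- With `r` of value `k` and `y` of value `n ≤ -1`, the power `k.toNat + 1` gives a negative total
  -- value.
  have h1 := hy (k.toNat + 1)
  have h2 : x ^ k * w * (x ^ n * u) ^ (k.toNat + 1) =
      x ^ (k + n * (k.toNat + 1 : ℕ)) * (w * u ^ (k.toNat + 1)) := by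
    rw [mul_pow, ← zpow_natCast (x ^ n), ← zpow_mul, zpow_add₀ h.ne_zero]; ring
  rw [h2] at h1
  have h3 := h.nonneg_of_mem (mul_ne_zero hw0 (pow_ne_zero _ hu0))
    (by rw [mul_inv, ← inv_pow]; exact V.mul_mem hw' (V.pow_mem hu' _)) h1
  push_cast at h3
  have := Int.self_le_toNat k
  have h4 : (0 : ℤ) ≤ k.toNat := Int.natCast_nonneg _
  nlinarith

/-- A nonunit of `V` is a multiple of the uniformizer. -/
theorem div_mem (h : V.IsUniformizer x) {v : K} (hv : v ∈ V) (hv' : v⁻¹ ∉ V) : v / x ∈ V := by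
  have hv0 : v ≠ 0 := by rintro rfl; exact hv' (by simp)
  obtain ⟨n, u, hu, hu', rfl⟩ := h.exists_eq v hv0
  have hu0 : u ≠ 0 := right_ne_zero_of_mul hv0
  have hn := h.nonneg_of_mem hu0 hu' hv
  have hn0 : n ≠ 0 := by
    rintro rfl
    exact hv' (by simpa using hu')
  have : x ^ n * u / x = x ^ (n - 1) * u := by
    rw [zpow_sub_one₀ h.ne_zero]; ring
  rw [this]
  exact V.mul_mem (h.zpow_mem (by omega)) hu

theorem exists_pow_div_mem (h : V.IsUniformizer x) {s a : K} (hs : s ∈ V) (hs' : s⁻¹ ∉ V)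
    (ha : a ≠ 0) : ∃ N : ℕ, s ^ N / a ∈ V := by
  obtain ⟨n, u, hu, hu', rfl⟩ := h.exists_eq a ha
  refine ⟨n.toNat, ?_⟩
  have h1 := h.div_mem hs hs'
  have hu0 : u ≠ 0 := right_ne_zero_of_mul ha
  have : s ^ n.toNat / (x ^ n * u) = (s / x) ^ n.toNat * x ^ (n.toNat - n : ℤ) * u⁻¹ := by
    rw [zpow_sub₀ h.ne_zero, zpow_natCast, div_pow]
    have := h.ne_zero
    have := zpow_ne_zero n this
    field_simp
  rw [this]
  exact V.mul_mem (V.mul_mem (V.pow_mem h1 _)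
    (h.zpow_mem (sub_nonneg.2 (Int.self_le_toNat n)))) hu'

end Subring.IsUniformizer

/-! ### Local TAF-domains of dimension one -/

namespace IsTAFRing

open IsLocalRing

variable {L : Type*} [CommRing L] [IsLocalRing L]

theorem maximalIdeal_le_radical_span [Ring.DimensionLEOne L] {y : L} (hy : y ≠ 0) :
    maximalIdeal L ≤ (Ideal.span {y}).radical := by
  refine le_radical_of_forall_isPrime fun Q hQ hyQ => ?_
  refine eq_maximalIdeal (hQ.isMaximal ?_)
  rintro rfl
  exact hy (by simpa using hyQ)

/-- For `x ∈ m \ m²` the ideal `(x)` is 2-absorbing, so `m² ⊆ (x)`, and in fact `m² ⊆ xm` because `x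
∉ m²`. Hence `a/x ∈ m : m` for every `a ∈ m`, and two elements of `m \ m²` differ by a unit of `m :
m`. -/
theorem exists_isUniformizer [IsDomain L] (h : IsTAFRing L) (hm : maximalIdeal L ≠ ⊥)
    (K : Type*) [Field K] [Algebra L K] [IsFractionRing L K] :
    ∃ x ∈ maximalIdeal L,
      ((maximalIdeal L).multiplierRing K).IsUniformizer (algebraMap L K x) := by
  have := h.dimensionLEOne
  set m := maximalIdeal L
  obtain ⟨y, hy, hy0⟩ := Submodule.exists_mem_ne_zero_of_ne_bot hm
  obtain ⟨x, hx, hx2⟩ : ∃ x ∈ m, x ∉ m ^ 2 := by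
    by_contra! hcon
    have := h.eq_of_maximalIdeal_le_radical (le_antisymm (Ideal.pow_le_self two_ne_zero) hcon)
      (maximalIdeal_le_radical_span (pow_ne_zero 2 hy0)) hy
    obtain ⟨c, hc⟩ := Ideal.mem_span_singleton.1 this
    have h1 : y * 1 = y * (y * c) := by linear_combination hc
    exact hy (IsUnit.of_mul_eq_one c (mul_left_cancel₀ hy0 h1).symm)
  have hne0 : ∀ a, a ∉ m ^ 2 → a ≠ 0 := fun a ha h0 => ha (h0 ▸ Ideal.zero_mem _)
  have hdvd : ∀ x ∈ m, x ∉ m ^ 2 → ∀ a ∈ m ^ 2, ∃ c ∈ m, a = x * c := by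
    intro x hx hx2 a ha
    have hne : Ideal.span {x} ≠ ⊤ := by
      rwa [Ne, Ideal.span_singleton_eq_top]
    have h1 : IsTwoAbsorbing (Ideal.span {x}) := (h.isTwoAbsorbing_or_le_sq hne).resolve_right
      fun h => hx2 (h (Ideal.mem_span_singleton_self x))
    obtain ⟨c, rfl⟩ := Ideal.mem_span_singleton.1
      (h1.pow_two_le (maximalIdeal_le_radical_span (hne0 x hx2)) ha)
    refine ⟨c, fun hc => hx2 ?_, rfl⟩
    rwa [Ideal.mul_unit_mem_iff_mem _ hc] at ha
  have hinj := IsFractionRing.injective L K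
  have hx0 : algebraMap L K x ≠ 0 := by
    rw [Ne, map_eq_zero_iff _ hinj]; exact hne0 x hx2
  have hdiv : ∀ x ∈ m, x ∉ m ^ 2 → ∀ a ∈ m,
      algebraMap L K a / algebraMap L K x ∈ m.multiplierRing K := by
    intro x hx hx2 a ha b hb
    obtain ⟨c, hc, hac⟩ := hdvd x hx hx2 (a * b) (by rw [pow_two]; exact Ideal.mul_mem_mul ha hb)
    refine ⟨c, hc, ?_⟩
    have : algebraMap L K x ≠ 0 := by
      rw [Ne, map_eq_zero_iff _ hinj]; exact hne0 x hx2
    rw [div_mul_eq_mul_div, ← map_mul, hac, map_mul, mul_div_cancel_left₀ _ this]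
  have hfactor : ∀ a ∈ m, a ≠ 0 → ∃ (n : ℕ) (u : K), u ∈ m.multiplierRing K ∧
      u⁻¹ ∈ m.multiplierRing K ∧ algebraMap L K a = algebraMap L K x ^ n * u := by
    classical
    intro a ha ha0
    -- Since `m^(2k) ⊆ (a)`, writing `a = x^(2k) c` would make `c` a unit. Extracting the largest
    -- power of `x` therefore leaves `c ∈ m \ m²`.
    have hbound : ∃ n, ¬ ∃ c ∈ m, a = x ^ n * c := by
      obtain ⟨k, hk⟩ := h.exists_pow_le (maximalIdeal_le_radical_span ha0)
      refine ⟨2 * k, ?_⟩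
      rintro ⟨c, hc, hac⟩
      obtain ⟨d, hd⟩ := Ideal.mem_span_singleton.1 (hk (Ideal.pow_mem_pow hx (2 * k)))
      have : a * 1 = a * (c * d) := by
        rw [hd] at hac; linear_combination hac
      exact hc (IsUnit.of_mul_eq_one d (mul_left_cancel₀ ha0 this).symm)
    have h0 : Nat.find hbound ≠ 0 := by
      intro h0
      exact Nat.find_spec hbound (by rw [h0]; exact ⟨a, ha, by simp⟩)
    obtain ⟨n, hn⟩ := Nat.exists_eq_succ_of_ne_zero h0
    obtain ⟨c, hc, hac⟩ := not_not.1 (Nat.find_min hbound (m := n) (by omega))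
    have hc2 : c ∉ m ^ 2 := by
      intro hc2
      obtain ⟨c', hc', hcc'⟩ := hdvd x hx hx2 c hc2
      refine Nat.find_spec hbound ⟨c', hc', ?_⟩
      rw [hn, hac, hcc', pow_succ, mul_assoc]
    refine ⟨n + 1, algebraMap L K c / algebraMap L K x, hdiv x hx hx2 c hc, ?_, ?_⟩
    · rw [inv_div]; exact hdiv c hc hc2 x hx
    · rw [hac, map_mul, map_pow, pow_succ]; field_simp
  refine ⟨x, hx, Ideal.algebraMap_mem_multiplierRing m x, hx0, ?_, ?_⟩
  · intro hinv
    obtain ⟨b, hb, hxb⟩ := hinv x hx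
    rw [inv_mul_cancel₀ hx0, ← map_one (algebraMap L K)] at hxb
    rw [← hinj hxb] at hb
    exact hb isUnit_one
  · intro y hy0
    obtain ⟨a, b, hb, rfl⟩ := IsFractionRing.div_surjective L y
    have hb0 : b ≠ 0 := nonZeroDivisors.ne_zero hb
    have ha0 : a ≠ 0 := by rintro rfl; simp at hy0
    -- Numerator and denominator are multiplied by `x` to bring both into `m`.
    obtain ⟨n, u, hu, hu', ha⟩ := hfactor (x * a) (m.mul_mem_right _ hx)
      (mul_ne_zero (hne0 x hx2) ha0)
    obtain ⟨k, w, hw, hw', hb⟩ := hfactor (x * b) (m.mul_mem_right _ hx)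
      (mul_ne_zero (hne0 x hx2) hb0)
    refine ⟨n - k, u * w⁻¹, mul_mem hu hw', by rw [mul_inv, inv_inv]; exact mul_mem hu' hw, ?_⟩
    rw [← mul_div_mul_left _ _ hx0, ← map_mul, ← map_mul, ha, hb, zpow_sub₀ hx0,
      zpow_natCast, zpow_natCast]
    rw [mul_div_mul_comm, div_eq_mul_inv u]

end IsTAFRing

/-! ### Finite character -/

/-- `P` becomes nilpotent modulo `I` after localizing at `P`: otherwise a prime over `I` avoiding
both `R \ P` and the powers of `d` would lie strictly below `P`. -/
theorem Ideal.exists_mul_pow_mem_of_mem_minimalPrimes {R : Type*} [CommRing R] {I P : Ideal R}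
    (hP : P ∈ I.minimalPrimes) {d : R} (hd : d ∈ P) : ∃ s ∉ P, ∃ n : ℕ, s * d ^ n ∈ I := by
  have hPprime : P.IsPrime := hP.1.1
  by_contra! hcon
  have hdisj : Disjoint (I : Set R) (P.primeCompl ⊔ Submonoid.powers d :) := by
    rw [Set.disjoint_right]
    intro y hy hyI
    obtain ⟨s, hs, _, ⟨n, rfl⟩, rfl⟩ := Submonoid.mem_sup.1 hy
    exact hcon s hs n hyI
  obtain ⟨Q, hQ, hIQ, hQd⟩ := Ideal.exists_le_prime_disjoint _ _ hdisj
  have hQP : Q ≤ P := fun y hy => by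
    by_contra hyP
    exact Set.disjoint_left.1 hQd hy (SetLike.le_def.1 le_sup_left hyP)
  exact Set.disjoint_left.1 hQd (hP.2 ⟨hQ, hIQ⟩ hQP hd)
    (SetLike.le_def.1 le_sup_right (Submonoid.mem_powers d))

/-- Take `a, b, c`, each in exactly one of three distinct maximal ideals. Their product lies in all
three, which are minimal over `J`, so `s(abc)^n ∈ J` for a suitable `s`. The factors `sa^n, b^n,
c^n` then contradict the 2-absorbing property, as each pair misses one of the ideals. -/
theorem IsTwoAbsorbing.eq_or_eq_or_eq_of_le_isMaximal {R : Type*} [CommRing R]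
    [IsDomain R] [Ring.DimensionLEOne R] {J : Ideal R} (hJ : IsTwoAbsorbing J) (hJ0 : J ≠ ⊥)
    {M₁ M₂ M₃ : Ideal R} (h₁ : M₁.IsMaximal) (h₂ : M₂.IsMaximal) (h₃ : M₃.IsMaximal)
    (hJ₁ : J ≤ M₁) (hJ₂ : J ≤ M₂) (hJ₃ : J ≤ M₃) : M₁ = M₂ ∨ M₁ = M₃ ∨ M₂ = M₃ := by
  by_contra! hne
  have hp₁ := h₁.isPrime
  have hp₂ := h₂.isPrime
  have hp₃ := h₃.isPrime
  have hpick : ∀ {A B C : Ideal R}, A.IsMaximal → B.IsMaximal → C.IsMaximal → A ≠ B → A ≠ C →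
      ∃ a ∈ A, a ∉ B ∧ a ∉ C := by
    intro A B C hA hB hC hAB hAC
    by_contra! hcon
    have hsub : (A : Set R) ⊆ B ∪ C := fun a ha => by
      by_cases hB : a ∈ B
      · exact Or.inl hB
      · exact Or.inr (hcon a ha hB)
    rcases Ideal.subset_union.1 hsub with h | h
    · exact hAB (hA.eq_of_le hB.ne_top h)
    · exact hAC (hA.eq_of_le hC.ne_top h)
  obtain ⟨a, ha₁, ha₂, ha₃⟩ := hpick h₁ h₂ h₃ hne.1 hne.2.1
  obtain ⟨b, hb₂, hb₁, hb₃⟩ := hpick h₂ h₁ h₃ hne.1.symm hne.2.2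
  obtain ⟨c, hc₃, hc₁, hc₂⟩ := hpick h₃ h₁ h₂ hne.2.1.symm hne.2.2.symm
  let A : Ideal R :=
    { carrier := {s | ∃ n, s * (a * b * c) ^ n ∈ J}
      add_mem' := by
        rintro s t ⟨n, hn⟩ ⟨k, hk⟩
        refine ⟨n + k, ?_⟩
        have : (s + t) * (a * b * c) ^ (n + k) = (a * b * c) ^ k * (s * (a * b * c) ^ n) +
            (a * b * c) ^ n * (t * (a * b * c) ^ k) := by ring
        rw [this]
        exact J.add_mem (J.mul_mem_left _ hn) (J.mul_mem_left _ hk)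
      zero_mem' := ⟨0, by simp⟩
      smul_mem' := by
        rintro r s ⟨n, hn⟩
        exact ⟨n, by rw [smul_eq_mul, mul_assoc]; exact J.mul_mem_left _ hn⟩ }
  have hA : ∀ M : Ideal R, M.IsMaximal → J ≤ M → a * b * c ∈ M → ∃ s ∈ A, s ∉ M := by
    intro M hM hJM habc
    obtain ⟨s, hs, n, hn⟩ := Ideal.exists_mul_pow_mem_of_mem_minimalPrimes (I := J) (P := M)
      ⟨⟨hM.isPrime, hJM⟩, fun Q hQ hQM => ((hQ.1.isMaximal
        (ne_bot_of_le_ne_bot hJ0 hQ.2)).eq_of_le hM.ne_top hQM).ge⟩ habc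
    exact ⟨s, ⟨n, hn⟩, hs⟩
  -- `A` is contained in none of the three maximal ideals, so prime avoidance gives a single `s`
  -- outside all of them.
  obtain ⟨s, ⟨n, hn⟩, hs₁, hs₂, hs₃⟩ : ∃ s ∈ A, s ∉ M₁ ∧ s ∉ M₂ ∧ s ∉ M₃ := by
    classical
    by_contra! hcon
    have := (Ideal.subset_union_prime (I := A) (s := {M₁, M₂, M₃}) (f := id) M₁ M₁ (by
      simp only [Finset.mem_insert, Finset.mem_singleton, id]
      rintro M (rfl | rfl | rfl) - - <;> assumption)).1 (fun s hs => by
      simp only [Finset.coe_insert, Finset.coe_singleton, Set.mem_insert_iff,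
        Set.mem_singleton_iff, Set.iUnion_iUnion_eq_or_left, Set.iUnion_iUnion_eq_left,
        Set.mem_union, SetLike.mem_coe, id]
      have := hcon s hs
      tauto)
    simp only [Finset.mem_insert, Finset.mem_singleton, id] at this
    obtain ⟨M, rfl | rfl | rfl, hM⟩ := this
    · obtain ⟨s, hs, hs'⟩ := hA M h₁ hJ₁ (Ideal.mul_mem_right _ _ (Ideal.mul_mem_right _ _ ha₁))
      exact hs' (hM hs)
    · obtain ⟨s, hs, hs'⟩ := hA M h₂ hJ₂ (Ideal.mul_mem_right _ _ (Ideal.mul_mem_left _ _ hb₂))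
      exact hs' (hM hs)
    · obtain ⟨s, hs, hs'⟩ := hA M h₃ hJ₃ (Ideal.mul_mem_left _ _ hc₃)
      exact hs' (hM hs)
  have hmul : ∀ {M : Ideal R}, M.IsPrime → ∀ {x y : R}, x ∉ M → y ∉ M → x * y ∉ M :=
    fun hM x y hx hy hxy => (hM.mem_or_mem hxy).elim hx hy
  have hpow : ∀ {M : Ideal R}, M.IsPrime → ∀ {x : R}, x ∉ M → x ^ n ∉ M :=
    fun hM x hx hxn => hx (hM.mem_of_pow_mem n hxn)
  have : s * a ^ n * b ^ n * c ^ n ∈ J := by convert hn using 1; ring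
  rcases hJ _ _ _ this with h | h | h
  · exact hmul hp₃ (hmul hp₃ hs₃ (hpow hp₃ ha₃)) (hpow hp₃ hb₃) (hJ₃ h)
  · exact hmul hp₂ (hmul hp₂ hs₂ (hpow hp₂ ha₂)) (hpow hp₂ hc₂) (hJ₂ h)
  · exact hmul hp₁ (hpow hp₁ hb₁) (hpow hp₁ hc₁) (hJ₁ h)

theorem IsTAFRing.finite_setOf_isMaximal_mem {R : Type*} [CommRing R] [IsDomain R]
    (h : IsTAFRing R) {a : R} (ha : a ≠ 0) : {M : Ideal R | M.IsMaximal ∧ a ∈ M}.Finite := by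
  have := h.dimensionLEOne
  by_cases hu : IsUnit a
  · convert Set.finite_empty
    ext M
    simp only [Set.mem_ofPred_eq, Set.mem_empty_iff_false, iff_false, not_and]
    exact fun hM haM => hM.ne_top (Ideal.eq_top_of_isUnit_mem _ haM hu)
  obtain ⟨s, hs, hprod⟩ := h.exists_proper_factors (I := Ideal.span {a})
    (by rwa [Ne, Ideal.span_singleton_eq_top])
  have hfin : ∀ J ∈ s, {M : Ideal R | M.IsMaximal ∧ J ≤ M}.Finite := by
    intro J hJ
    have hJ0 : J ≠ ⊥ := by
      rintro rfl
      exact ha (by simpa using (hs ⊥ hJ).2.2)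
    by_contra hinf
    obtain ⟨t, ht, htc⟩ := Set.Infinite.exists_subset_card_eq hinf 3
    obtain ⟨M₁, M₂, M₃, h12, h13, h23, rfl⟩ := Finset.card_eq_three.1 htc
    simp only [Finset.coe_insert, Finset.coe_singleton, Set.insert_subset_iff,
      Set.singleton_subset_iff, Set.mem_ofPred_eq] at ht
    obtain ⟨h1, h2, h3⟩ := ht
    rcases (hs J hJ).1.eq_or_eq_or_eq_of_le_isMaximal hJ0 h1.1 h2.1 h3.1 h1.2 h2.2 h3.2 with
      h | h | h
    exacts [h12 h, h13 h, h23 h]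
  refine (Set.Finite.biUnion (s := {J | J ∈ s}) (Multiset.finite_toSet s) hfin).subset ?_
  rintro M ⟨hM, haM⟩
  obtain ⟨J, hJ, hJM⟩ := (Ideal.IsPrime.multiset_prod_le hM.isPrime).1
    (hprod.trans_le (by rwa [Ideal.span_singleton_le_iff_mem]))
  exact Set.mem_biUnion hJ ⟨hM, hJM⟩

/-! ### Invertible ideals -/

open scoped nonZeroDivisors in
/-- An ideal that is locally generated by one element, in the sense that for each maximal ideal `Q`
some `s ∉ Q` satisfies `s I ⊆ a T` with `a ∈ I`, is invertible. -/
theorem Ideal.coeIdeal_mul_inv_of_forall_isMaximal {T : Type*} (F : Type*) [CommRing T] [IsDomain T]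
    [Field F] [Algebra T F] [IsFractionRing T F] {I : Ideal T}
    (h : ∀ Q : Ideal T, Q.IsMaximal → ∃ a ∈ I, a ≠ 0 ∧ ∃ s, s ∉ Q ∧ ∀ b ∈ I, a ∣ s * b) :
    (I : FractionalIdeal T⁰ F) * (I : FractionalIdeal T⁰ F)⁻¹ = 1 := by
  have hI0 : I ≠ ⊥ := by
    obtain ⟨Q, hQ⟩ := Ideal.exists_maximal T
    obtain ⟨a, ha, ha0, -⟩ := h Q hQ
    exact fun hI => ha0 (by simpa [hI] using ha)
  have hI0' : (I : FractionalIdeal T⁰ F) ≠ 0 := FractionalIdeal.coeIdeal_ne_zero.2 hI0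
  obtain ⟨J, hJ⟩ := FractionalIdeal.le_one_iff_exists_coeIdeal.1
    (FractionalIdeal.mul_one_div_le_one (I := (I : FractionalIdeal T⁰ F)))
  rw [← FractionalIdeal.inv_eq] at hJ
  rw [← hJ]
  suffices J = ⊤ by rw [this, FractionalIdeal.coeIdeal_top]
  by_contra hJt
  obtain ⟨Q, hQ, hJQ⟩ := Ideal.exists_le_maximal J hJt
  obtain ⟨a, ha, ha0, s, hs, hdvd⟩ := h Q hQ
  refine hs (hJQ ?_)
  have ha0' : algebraMap T F a ≠ 0 := by
    rwa [Ne, map_eq_zero_iff _ (IsFractionRing.injective T F)]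
  have hmem : algebraMap T F s / algebraMap T F a ∈ (I : FractionalIdeal T⁰ F)⁻¹ := by
    rw [FractionalIdeal.mem_inv_iff hI0']
    intro y hy
    obtain ⟨b, hb, rfl⟩ := (FractionalIdeal.mem_coeIdeal _).1 hy
    obtain ⟨t, ht⟩ := hdvd b hb
    rw [div_mul_eq_mul_div, ← map_mul, ht, map_mul, mul_div_cancel_left₀ _ ha0']
    exact FractionalIdeal.coe_mem_one _ t
  have := FractionalIdeal.mul_mem_mul (FractionalIdeal.mem_coeIdeal_of_mem T⁰ ha) hmem
  rw [mul_div_cancel₀ _ ha0', ← hJ] at this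
  obtain ⟨s', hs', hss⟩ := (FractionalIdeal.mem_coeIdeal _).1 this
  rwa [← IsFractionRing.injective T F hss]

open scoped nonZeroDivisors in
theorem isDedekindDomain_of_forall_ideal {T : Type*} [CommRing T] [IsDomain T]
    (h : ∀ I : Ideal T, I ≠ ⊥ → ∀ Q : Ideal T, Q.IsMaximal →
      ∃ a ∈ I, a ≠ 0 ∧ ∃ s, s ∉ Q ∧ ∀ b ∈ I, a ∣ s * b) : IsDedekindDomain T := by
  rw [isDedekindDomain_iff_mul_inv_cancel (K := FractionRing T)]
  intro I hI
  obtain ⟨a, J, ha, rfl⟩ := FractionalIdeal.exists_eq_spanSingleton_mul I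
  have hJ : J ≠ ⊥ := by
    rintro rfl
    exact hI (by simp)
  have h1 := Ideal.coeIdeal_mul_inv_of_forall_isMaximal (FractionRing T) (h J hJ)
  have ha' : algebraMap T (FractionRing T) a ≠ 0 := by
    rwa [Ne, map_eq_zero_iff _ (IsFractionRing.injective T _)]
  rw [FractionalIdeal.mul_inv_cancel_iff]
  refine ⟨FractionalIdeal.spanSingleton T⁰ (algebraMap T (FractionRing T) a) *
    (J : FractionalIdeal T⁰ (FractionRing T))⁻¹, ?_⟩
  rw [mul_mul_mul_comm, h1, mul_one, FractionalIdeal.spanSingleton_mul_spanSingleton,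
    inv_mul_cancel₀ ha', FractionalIdeal.spanSingleton_one]

/-! ### The overring `M R_M : M R_M` -/

/-- `V` is a discrete valuation ring of `K` with the same maximal ideal as the localization of `R`
at its maximal ideal `M`. -/
structure IsLocalHull {R K : Type*} [CommRing R] [Field K] [Algebra R K] (M : Ideal R)
    (V : Subring K) : Prop where
  exists_isUniformizer : ∃ x, V.IsUniformizer x
  algebraMap_mem : ∀ r, algebraMap R K r ∈ V
  inv_mem : ∀ s, s ∉ M → (algebraMap R K s)⁻¹ ∈ V
  inv_notMem : ∀ s ∈ M, s ≠ 0 → (algebraMap R K s)⁻¹ ∉ V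
  exists_eq_div : ∀ v ∈ V, (v ≠ 0 → v⁻¹ ∉ V) →
    ∃ a ∈ M, ∃ s ∉ M, v = algebraMap R K a / algebraMap R K s

/-- The witness is `m : m` for the localization `L` of `R` at `M`, with maximal ideal `m`. -/
theorem IsTAFRing.exists_isLocalHull {R : Type*} (K : Type*) [CommRing R] [IsDomain R] [Field K]
    [Algebra R K] [IsFractionRing R K] (h : IsTAFRing R) {M : Ideal R} (hM : M.IsMaximal)
    (hM0 : M ≠ ⊥) : ∃ V : Subring K, IsLocalHull M V := by
  have := hM.isPrime
  let L := Localization.subalgebra.ofField K M.primeCompl M.primeCompl_le_nonZeroDivisors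
  have : IsLocalization.AtPrime L M :=
    inferInstanceAs (IsLocalization M.primeCompl L)
  have : IsLocalRing L := IsLocalization.AtPrime.isLocalRing L M
  have hmem : ∀ r : R, algebraMap R L r ∈ IsLocalRing.maximalIdeal L ↔ r ∈ M :=
    fun r => IsLocalization.AtPrime.to_map_mem_maximal_iff L M r
  have hinj : Function.Injective (algebraMap R L) :=
    IsLocalization.injective L M.primeCompl_le_nonZeroDivisors
  have hinjK : Function.Injective (algebraMap R K) := IsFractionRing.injective R K
  have hm : IsLocalRing.maximalIdeal L ≠ ⊥ := by
    obtain ⟨y, hy, hy0⟩ := Submodule.exists_mem_ne_zero_of_ne_bot hM0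
    intro hbot
    have := (hmem y).2 hy
    rw [hbot, Ideal.mem_bot, map_eq_zero_iff _ hinj] at this
    exact hy0 this
  have hdiv : ∀ l ∈ IsLocalRing.maximalIdeal L, ∃ a ∈ M, ∃ s ∉ M,
      (l : K) = algebraMap R K a / algebraMap R K s := by
    intro l hl
    obtain ⟨⟨a, s⟩, has⟩ := IsLocalization.surj M.primeCompl l
    refine ⟨a, ?_, s, s.2, ?_⟩
    · rw [← hmem, ← has]
      exact Ideal.mul_mem_right _ _ hl
    · have hs0 : algebraMap R K s ≠ 0 := by
        rw [Ne, map_eq_zero_iff _ hinjK]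
        exact fun h0 => s.2 (h0 ▸ M.zero_mem)
      rw [eq_div_iff hs0]
      exact congrArg (Subtype.val) has
  obtain ⟨x, hx, hxu⟩ := (h.of_isLocalization M.primeCompl L).exists_isUniformizer hm K
  refine ⟨(IsLocalRing.maximalIdeal L).multiplierRing K, ⟨_, hxu⟩, fun r => ?_, fun s hs => ?_,
    fun s hs hs0 hinv => ?_, fun v hv hv' => ?_⟩
  · exact Ideal.algebraMap_mem_multiplierRing _ (algebraMap R L r)
  · have hu : IsUnit (algebraMap R L s) := IsLocalization.map_units L (⟨s, hs⟩ : M.primeCompl)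
    obtain ⟨t, ht⟩ := hu.exists_right_inv
    convert Ideal.algebraMap_mem_multiplierRing (IsLocalRing.maximalIdeal L) t (K := K)
    have ht' : algebraMap R K s * (t : K) = 1 := congrArg Subtype.val ht
    exact inv_eq_of_mul_eq_one_right ht'
  · obtain ⟨b, hb, hsb⟩ := hinv _ ((hmem s).2 hs)
    have h1 : (algebraMap R K s)⁻¹ * algebraMap R K s = b := hsb
    rw [inv_mul_cancel₀ (by rwa [Ne, map_eq_zero_iff _ hinjK])] at h1
    have : b = 1 := Subtype.ext h1.symm
    exact hb (this ▸ isUnit_one)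
  · by_cases hv0 : v = 0
    · obtain ⟨a, ha, s, hs, h0⟩ := hdiv 0 (Ideal.zero_mem _)
      exact ⟨a, ha, s, hs, hv0.trans h0⟩
    -- A nonunit `v` equals `(v/x) · x` with `v/x ∈ m : m` and `x ∈ m`, so it lies in `m`.
    obtain ⟨b, hb, hvb⟩ := hxu.div_mem hv (hv' hv0) x hx
    rw [div_mul_cancel₀ _ hxu.ne_zero] at hvb
    rw [hvb]
    exact hdiv b hb

/-! ### The complete integral closure as an intersection of local hulls -/

namespace IsLocalHull

variable {R K : Type*} [CommRing R] [Field K] [Algebra R K] {M : Ideal R} {V : Subring K}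

theorem exists_mul_eq_div (h : IsLocalHull M V) {b : R} (hb : b ∈ M) {v : K} (hv : v ∈ V) :
    ∃ a ∈ M, ∃ s ∉ M, algebraMap R K b * v = algebraMap R K a / algebraMap R K s := by
  refine h.exists_eq_div _ (V.mul_mem (h.algebraMap_mem b) hv) fun h0 hinv => ?_
  have hv0 : v ≠ 0 := right_ne_zero_of_mul h0
  have hb0 : b ≠ 0 := by rintro rfl; simp at h0
  refine h.inv_notMem b hb hb0 ?_
  have := V.mul_mem hinv hv
  rwa [mul_inv, mul_assoc, inv_mul_cancel₀ hv0, mul_one] at this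

variable [IsFractionRing R K] {W : MaximalSpectrum R → Subring K}

theorem _root_.exists_algebraMap_eq_of_forall_maximalSpectrum [IsDomain R] {y : K}
    (h : ∀ M : MaximalSpectrum R, ∃ a, ∃ s ∉ M.asIdeal, y = algebraMap R K a / algebraMap R K s) :
    ∃ r : R, algebraMap R K r = y := by
  have := MaximalSpectrum.iInf_localization_eq_bot R K
  have hy : y ∈ (⊥ : Subalgebra R K) := by
    rw [← this, Algebra.mem_iInf]
    intro M
    obtain ⟨a, s, hs, hy⟩ := h M
    exact ⟨a, s, hs, by rw [hy, div_eq_mul_inv]⟩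
  exact Algebra.mem_bot.1 hy

/-- One inclusion holds because each `W M` is completely integrally closed. For the other, if `y =
a/b` lies in every `W M`, then `b` is a common denominator for all powers: where `b ∈ M`, `b · W M`
lies in `R_M`, and where `b ∉ M` already `y ∈ R_M`. -/
theorem mem_completeIntegralClosure_iff [IsDomain R]
    (hW : ∀ M : MaximalSpectrum R, IsLocalHull M.asIdeal (W M))
    {y : K} : y ∈ completeIntegralClosure R K ↔ ∀ M, y ∈ W M := by
  have hinj := IsFractionRing.injective R K
  constructor
  · rintro ⟨r, hr, hy⟩ M
    obtain ⟨x, hx⟩ := (hW M).exists_isUniformizer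
    refine hx.mem_of_forall_mul_pow_mem (r := algebraMap R K r) ?_ fun n => ?_
    · rw [Ne, map_eq_zero_iff _ hinj]
      exact nonZeroDivisors.ne_zero hr
    · obtain ⟨t, ht⟩ := hy n
      rw [← Algebra.smul_def, ← ht]
      exact (hW M).algebraMap_mem t
  · intro h
    obtain ⟨a, b, hb, rfl⟩ := IsFractionRing.div_surjective R y
    refine ⟨b, hb, fun n => ?_⟩
    obtain ⟨r, hr⟩ := exists_algebraMap_eq_of_forall_maximalSpectrum
      (y := b • (algebraMap R K a / algebraMap R K b) ^ n) fun M => by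
        rw [Algebra.smul_def]
        by_cases hbM : b ∈ M.asIdeal
        · obtain ⟨c, -, s, hs, hc⟩ := (hW M).exists_mul_eq_div hbM ((W M).pow_mem (h M) n)
          exact ⟨c, s, hs, hc⟩
        · have := M.isMaximal.isPrime
          refine ⟨b * a ^ n, b ^ n, fun h => hbM (this.mem_of_pow_mem n h), ?_⟩
          rw [map_mul, map_pow, map_pow, div_pow]; ring
    exact ⟨r, hr⟩

/-- A one-sided approximation: only finitely many maximal ideals contain the numerator of `y`, and
at each of them other than `M` a high power of an element outside `M` absorbs it. -/
theorem exists_mul_mem (hW : ∀ M : MaximalSpectrum R, IsLocalHull M.asIdeal (W M))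
    (hfin : ∀ a : R, a ≠ 0 → {M : MaximalSpectrum R | a ∈ M.asIdeal}.Finite)
    (M : MaximalSpectrum R) {y : K} (hy : y ≠ 0) :
    ∃ s ∉ M.asIdeal, ∀ M', M' ≠ M → algebraMap R K s / y ∈ W M' := by
  classical
  have hinj := IsFractionRing.injective R K
  obtain ⟨a, b, hb, rfl⟩ := IsFractionRing.div_surjective R y
  have ha0 : a ≠ 0 := by rintro rfl; simp at hy
  have hM := M.isMaximal.isPrime
  have hex : ∀ M' : MaximalSpectrum R, ∃ t ∉ M.asIdeal, M' ≠ M →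
      algebraMap R K t / algebraMap R K a ∈ W M' := by
    intro M'
    by_cases hMM : M' = M
    · exact ⟨1, fun h => M.isMaximal.ne_top ((Ideal.eq_top_iff_one _).2 h), fun h => (h hMM).elim⟩
    · obtain ⟨t, ht', ht⟩ : ∃ t ∈ M'.asIdeal, t ∉ M.asIdeal := by
        by_contra! hcon
        exact hMM (MaximalSpectrum.ext (M'.isMaximal.eq_of_le M.isMaximal.ne_top hcon))
      have ht0 : t ≠ 0 := fun h => ht (h ▸ Ideal.zero_mem _)
      obtain ⟨x, hx⟩ := (hW M').exists_isUniformizer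
      obtain ⟨N, hN⟩ := hx.exists_pow_div_mem ((hW M').algebraMap_mem t)
        ((hW M').inv_notMem t ht' ht0) (a := algebraMap R K a)
        (by rwa [Ne, map_eq_zero_iff _ hinj])
      exact ⟨t ^ N, fun h => ht (hM.mem_of_pow_mem N h), fun _ => by rwa [map_pow]⟩
  choose t ht ht' using hex
  refine ⟨∏ M' ∈ (hfin a ha0).toFinset, t M', fun h => ?_, fun M' hM' => ?_⟩
  · obtain ⟨M', -, hM'⟩ := hM.prod_mem_iff.1 h
    exact ht M' hM'
  · rw [div_div_eq_mul_div, mul_div_right_comm]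
    refine (W M').mul_mem ?_ ((hW M').algebraMap_mem b)
    by_cases haM : a ∈ M'.asIdeal
    · rw [← Finset.mul_prod_erase _ _ ((hfin a ha0).mem_toFinset.2 haM), map_mul,
        mul_div_right_comm]
      exact (W M').mul_mem (ht' M' hM') ((hW M').algebraMap_mem _)
    · rw [div_eq_mul_inv]
      exact (W M').mul_mem ((hW M').algebraMap_mem _) ((hW M').inv_mem a haM)

end IsLocalHull

/-! ### Pseudo-Dedekind pairs -/

/-- The extension `R → T` is injective with a nonzero conductor, the nonzero primes `Q` of `T` lie
over maximal ideals of `R`, and `R_M` contains the maximal ideal of `T_M`, for `M = Q ∩ R`. -/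
structure IsPseudoDedekind (R T : Type*) [CommRing R] [CommRing T] [Algebra R T] : Prop where
  injective : Function.Injective (algebraMap R T)
  exists_conductor : ∃ c : R, c ≠ 0 ∧ ∀ t : T, ∃ r : R, algebraMap R T r = algebraMap R T c * t
  isMaximal_comap : ∀ Q : Ideal T, Q.IsPrime → Q ≠ ⊥ → (Q.comap (algebraMap R T)).IsMaximal
  exists_separator : ∀ Q : Ideal T, Q.IsPrime → Q ≠ ⊥ → ∃ s : R, algebraMap R T s ∉ Q ∧
    ∀ q ∈ Q, ∃ r : R, algebraMap R T r = algebraMap R T s * q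

/-! ### TAF-domains -/

section TAF

variable {R K : Type*} [CommRing R] [IsDomain R] [Field K] [Algebra R K] [IsFractionRing R K]

theorem Subalgebra.comap_ne_bot_of_ne_bot (T : Subalgebra R K) {Q : Ideal T} (hQ : Q ≠ ⊥) :
    Q.comap (algebraMap R T) ≠ ⊥ := by
  obtain ⟨q, hq, hq0⟩ := Submodule.exists_mem_ne_zero_of_ne_bot hQ
  obtain ⟨a, b, hb, hab⟩ := IsFractionRing.div_surjective R (q : K)
  have hb0 : algebraMap R K b ≠ 0 := by
    rw [Ne, map_eq_zero_iff _ (IsFractionRing.injective R K)]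
    exact nonZeroDivisors.ne_zero hb
  have h1 : algebraMap R T a = algebraMap R T b * q := by
    refine Subtype.ext ?_
    change algebraMap R K a = algebraMap R K b * q
    rw [← hab, mul_div_cancel₀ _ hb0]
  intro hbot
  have ha : a ∈ Q.comap (algebraMap R T) := by
    rw [Ideal.mem_comap, h1]
    exact Q.mul_mem_left _ hq
  rw [hbot, Ideal.mem_bot] at ha
  refine hq0 (Subtype.ext ?_)
  rw [← hab, ha, map_zero, zero_div]; rfl

variable {W : MaximalSpectrum R → Subring K}

/-- At `Q` over `M`, an element `a ∈ I` of least value in `W M` generates `I` locally; the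
approximation lemma clears the denominators of `b/a` at the other maximal ideals. -/
theorem IsLocalHull.isDedekindDomain
    (hW : ∀ M : MaximalSpectrum R, IsLocalHull M.asIdeal (W M))
    (hfin : ∀ a : R, a ≠ 0 → {M : MaximalSpectrum R | a ∈ M.asIdeal}.Finite) :
    IsDedekindDomain (completeIntegralClosure R K) := by
  refine isDedekindDomain_of_forall_ideal fun I hI Q hQ => ?_
  obtain ⟨M₀, hM₀, hQM⟩ := Ideal.exists_le_maximal _
    (Ideal.comap_ne_top (algebraMap R (completeIntegralClosure R K)) hQ.ne_top)
  let M : MaximalSpectrum R := ⟨M₀, hM₀⟩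
  have hT : ∀ t : completeIntegralClosure R K, ∀ M, (t : K) ∈ W M := fun t =>
    (mem_completeIntegralClosure_iff hW).1 t.2
  obtain ⟨x, hx⟩ := (hW M).exists_isUniformizer
  obtain ⟨_, ⟨a, ha, rfl⟩, ha0, hdvd⟩ := hx.exists_dvd
    (I := Subtype.val '' (I : Set (completeIntegralClosure R K))) (by
      rintro _ ⟨b, -, rfl⟩
      exact hT b M) (by
      obtain ⟨b, hb, hb0⟩ := Submodule.exists_mem_ne_zero_of_ne_bot hI
      exact ⟨b, ⟨b, hb, rfl⟩, fun h => hb0 (Subtype.ext h)⟩)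
  obtain ⟨s, hs, hs'⟩ := exists_mul_mem hW hfin M ha0
  refine ⟨a, ha, fun h => ha0 (congrArg Subtype.val h),
    algebraMap R (completeIntegralClosure R K) s, fun h => hs (hQM h), fun b hb => ?_⟩
  refine ⟨⟨algebraMap R K s * b / a, (mem_completeIntegralClosure_iff hW).2 fun M' => ?_⟩,
    Subtype.ext ?_⟩
  · by_cases hM' : M' = M
    · subst hM'
      rw [mul_div_assoc]
      exact mul_mem ((hW M).algebraMap_mem s) (hdvd b ⟨b, hb, rfl⟩)
    · rw [mul_div_right_comm]
      exact mul_mem (hs' M' hM') (hT b M')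
  · change algebraMap R K s * b = a * (algebraMap R K s * b / a)
    rw [mul_div_cancel₀ _ ha0]

theorem IsLocalHull.isPseudoDedekind [Ring.DimensionLEOne R]
    (hW : ∀ M : MaximalSpectrum R, IsLocalHull M.asIdeal (W M))
    (hfin : ∀ a : R, a ≠ 0 → {M : MaximalSpectrum R | a ∈ M.asIdeal}.Finite)
    {c : R} (hc0 : c ≠ 0)
    (hc : ∀ t ∈ completeIntegralClosure R K, ∃ r : R, algebraMap R K r = algebraMap R K c * t) :
    IsPseudoDedekind R (completeIntegralClosure R K) := by
  classical
  have hinjK := IsFractionRing.injective R K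
  have hmax : ∀ Q : Ideal (completeIntegralClosure R K), Q.IsPrime → Q ≠ ⊥ →
      (Q.comap (algebraMap R (completeIntegralClosure R K))).IsMaximal := fun Q hQ hQ0 =>
    (Ideal.IsPrime.comap _).isMaximal (Subalgebra.comap_ne_bot_of_ne_bot _ hQ0)
  have hT : ∀ t : completeIntegralClosure R K, ∀ M, (t : K) ∈ W M := fun t =>
    (mem_completeIntegralClosure_iff hW).1 t.2
  refine ⟨fun a b hab => hinjK (congrArg Subtype.val hab), ⟨c, hc0, fun t => ?_⟩, hmax, ?_⟩
  · obtain ⟨r, hr⟩ := hc t t.2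
    exact ⟨r, Subtype.ext hr⟩
  intro Q hQ hQ0
  let M : MaximalSpectrum R := ⟨_, hmax Q hQ hQ0⟩
  have hex : ∀ M' : MaximalSpectrum R, ∃ t ∉ M.asIdeal, M' ≠ M → t ∈ M'.asIdeal := by
    intro M'
    by_cases hMM : M' = M
    · exact ⟨1, fun h => M.isMaximal.ne_top ((Ideal.eq_top_iff_one _).2 h), fun h => (h hMM).elim⟩
    · by_contra! hcon
      refine hMM (MaximalSpectrum.ext (M'.isMaximal.eq_of_le M.isMaximal.ne_top fun t ht' => ?_))
      by_contra ht
      exact (hcon t ht).2 ht'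
  choose t ht ht' using hex
  set s := ∏ M' ∈ (hfin c hc0).toFinset, t M' with hs
  refine ⟨s, fun h => ?_, fun q hq => ?_⟩
  · obtain ⟨M', -, hM'⟩ := M.isMaximal.isPrime.prod_mem_iff.1 (show s ∈ M.asIdeal from h)
    exact ht M' hM'
  have hone : ∀ M' : MaximalSpectrum R, (1 : R) ∉ M'.asIdeal := fun M' h =>
    M'.isMaximal.ne_top ((Ideal.eq_top_iff_one _).2 h)
  -- `sq ∈ R` is checked at each `M'`. At `M` itself `q` is a nonunit of `W M`, so lies in `M R_M`.
  -- If `M' ≠ M` contains `c`, then `s ∈ M'` and `s · W M' ⊆ R_{M'}`. Elsewhere `c` is a unit and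
  -- `cq ∈ R`.
  obtain ⟨r, hr⟩ := exists_algebraMap_eq_of_forall_maximalSpectrum (y := algebraMap R K s * q)
    fun M' => by
    by_cases hM' : M' = M
    · subst hM'
      -- Were `q` a unit of `W M`, some `u ∉ M` would have `u/q` in the complete integral closure,
      -- forcing `u ∈ Q`.
      obtain ⟨a, ha, s', hs', hq'⟩ := (hW M).exists_eq_div q (hT q M) fun hq0 hinv => by
        obtain ⟨u, hu, hu'⟩ := exists_mul_mem hW hfin M hq0
        have hmem : algebraMap R K u / q ∈ completeIntegralClosure R K :=
          (mem_completeIntegralClosure_iff hW).2 fun M' => by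
            by_cases hM' : M' = M
            · rw [hM', div_eq_mul_inv]
              exact mul_mem ((hW M).algebraMap_mem u) hinv
            · exact hu' M' hM'
        refine hu ?_
        change algebraMap R _ u ∈ Q
        have : algebraMap R (completeIntegralClosure R K) u = q * ⟨_, hmem⟩ := Subtype.ext (by
          change algebraMap R K u = q * (algebraMap R K u / q)
          rw [mul_div_cancel₀ _ hq0])
        rw [this]
        exact Q.mul_mem_right _ hq
      exact ⟨s * a, s', hs', by rw [hq', map_mul, mul_div_assoc]⟩
    by_cases hcM : c ∈ M'.asIdeal
    · have hsM : s ∈ M'.asIdeal := Ideal.mem_of_dvd _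
        (Finset.dvd_prod_of_mem t ((hfin c hc0).mem_toFinset.2 hcM)) (ht' M' hM')
      obtain ⟨a, -, s', hs', h⟩ := (hW M').exists_mul_eq_div hsM (hT q M')
      exact ⟨a, s', hs', h⟩
    · obtain ⟨r, hr⟩ := hc q q.2
      refine ⟨s * r, c, hcM, ?_⟩
      rw [map_mul, hr, eq_div_iff (by rwa [Ne, map_eq_zero_iff _ hinjK])]
      ring
  exact ⟨r, Subtype.ext hr⟩

theorem IsTAFRing.isPseudoDedekind_completeIntegralClosure (hR : ¬ IsField R) (h : IsTAFRing R)
    (hcond : overringConductor (completeIntegralClosure R K) ≠ ⊥) :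
    IsDedekindDomain (completeIntegralClosure R K) ∧
      IsPseudoDedekind R (completeIntegralClosure R K) := by
  have := h.dimensionLEOne
  have hex : ∀ M : MaximalSpectrum R, ∃ V : Subring K, IsLocalHull M.asIdeal V := fun M =>
    h.exists_isLocalHull K M.isMaximal (Ring.ne_bot_of_isMaximal_of_not_isField M.isMaximal hR)
  choose W hW using hex
  have hfin : ∀ a : R, a ≠ 0 → {M : MaximalSpectrum R | a ∈ M.asIdeal}.Finite := fun a ha =>
    Set.Finite.of_finite_image (f := MaximalSpectrum.asIdeal)
      ((h.finite_setOf_isMaximal_mem ha).subset (by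
        rintro _ ⟨M, hM, rfl⟩
        exact ⟨M.isMaximal, hM⟩))
      (fun M _ M' _ hMM => MaximalSpectrum.ext hMM)
  obtain ⟨x, hx, hx0⟩ := Submodule.exists_mem_ne_zero_of_ne_bot hcond
  rw [mem_overringConductor] at hx
  obtain ⟨c, hc⟩ := hx 1 (one_mem _)
  rw [mul_one] at hc
  subst hc
  exact ⟨IsLocalHull.isDedekindDomain hW hfin,
    IsLocalHull.isPseudoDedekind hW hfin (by rintro rfl; simp at hx0) hx⟩

end TAF

/-! ### Finite intersections of maximal ideals -/

theorem Ideal.isArtinianRing_quotient_sInf {R : Type*} [CommRing R] {S : Set (Ideal R)}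
    (hS : S.Finite) (hmax : ∀ M ∈ S, M.IsMaximal) {I : Ideal R} (hI : I = sInf S) :
    IsArtinianRing (R ⧸ I) := by
  have : Finite S := hS
  have hcop : Pairwise (Function.onFun IsCoprime fun M : S => (M : Ideal R)) := fun M N hne => by
    have := hmax M M.2
    have := hmax N N.2
    exact Ideal.isCoprime_of_isMaximal fun h => hne (Subtype.ext h)
  rw [sInf_eq_iInf'] at hI
  subst hI
  have : ∀ M : S, IsArtinianRing (R ⧸ (M : Ideal R)) := fun M =>
    haveI := hmax M M.2
    let _ := Ideal.Quotient.field (M : Ideal R)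
    inferInstance
  exact (Ideal.quotientInfRingEquivPiQuotient _ hcop).symm.surjective.isArtinianRing

/-- The conductor `R : T` as an ideal of `T`. -/
def algebraConductor (R T : Type*) [CommRing R] [CommRing T] [Algebra R T] : Ideal T where
  carrier := {t | ∀ u, ∃ r, algebraMap R T r = t * u}
  add_mem' := by
    intro s t hs ht u
    obtain ⟨a, ha⟩ := hs u
    obtain ⟨b, hb⟩ := ht u
    exact ⟨a + b, by rw [map_add, ha, hb, add_mul]⟩
  zero_mem' := fun u => ⟨0, by simp⟩
  smul_mem' := by
    intro c t ht u
    obtain ⟨a, ha⟩ := ht (c * u)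
    exact ⟨a, by rw [ha, smul_eq_mul]; ring⟩

theorem mem_algebraConductor {R T : Type*} [CommRing R] [CommRing T] [Algebra R T] {t : T} :
    t ∈ algebraConductor R T ↔ ∀ u, ∃ r, algebraMap R T r = t * u := Iff.rfl

theorem exists_algebraMap_eq_of_mem_algebraConductor {R T : Type*} [CommRing R] [CommRing T]
    [Algebra R T] {t : T} (ht : t ∈ algebraConductor R T) : ∃ r, algebraMap R T r = t := by
  simpa using ht 1

/-! ### Primes and conductor of a pseudo-Dedekind pair -/

namespace IsPseudoDedekind

variable {R T : Type*} [CommRing R] [CommRing T] [Algebra R T]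

theorem not_isField (h : IsPseudoDedekind R T) [IsDomain R] (hR : ¬ IsField R) : ¬ IsField T := by
  intro hT
  let _ := hT.toField
  refine hR ⟨⟨0, 1, zero_ne_one⟩, mul_comm, fun {a} ha => ?_⟩
  obtain ⟨c, hc0, hc⟩ := h.exists_conductor
  obtain ⟨r, hr⟩ := hc (algebraMap R T (c * a))⁻¹
  refine ⟨r, h.injective ?_⟩
  have h1 : algebraMap R T (c * a) ≠ 0 := by
    rw [Ne, map_eq_zero_iff _ h.injective]
    exact mul_ne_zero hc0 ha
  rw [map_mul, hr, map_one, ← mul_assoc, ← map_mul, mul_comm a c, mul_inv_cancel₀ h1]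

theorem algebraConductor_ne_bot (h : IsPseudoDedekind R T) : algebraConductor R T ≠ ⊥ := by
  obtain ⟨c, hc0, hc⟩ := h.exists_conductor
  intro hbot
  have : algebraMap R T c ∈ algebraConductor R T := hc
  rw [hbot, Ideal.mem_bot, map_eq_zero_iff _ h.injective] at this
  exact hc0 this

theorem comap_algebraConductor_ne_bot (h : IsPseudoDedekind R T) :
    (algebraConductor R T).comap (algebraMap R T) ≠ ⊥ := by
  obtain ⟨c, hc0, hc⟩ := h.exists_conductor
  intro hbot
  have : c ∈ (algebraConductor R T).comap (algebraMap R T) := hc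
  rw [hbot] at this
  exact hc0 this

theorem comap_eq_bot_iff (h : IsPseudoDedekind R T) [IsDomain R] (hR : ¬ IsField R) {Q : Ideal T}
    (hQ : Q.IsPrime) : Q.comap (algebraMap R T) = ⊥ ↔ Q = ⊥ := by
  refine ⟨fun hbot => ?_, fun hbot => ?_⟩
  · by_contra hQ0
    exact Ring.ne_bot_of_isMaximal_of_not_isField (h.isMaximal_comap Q hQ hQ0) hR hbot
  · rw [hbot]
    exact Ideal.comap_bot_of_injective _ h.injective

/-- For `q ∈ Q` the separator puts `sq` in `Q ∩ R = Q' ∩ R`, while `s ∉ Q'`. -/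
theorem eq_of_comap_eq (h : IsPseudoDedekind R T) {Q Q' : Ideal T} (hQ : Q.IsPrime)
    (hQ' : Q'.IsPrime) (hQ0 : Q ≠ ⊥) (hQ'0 : Q' ≠ ⊥)
    (heq : Q.comap (algebraMap R T) = Q'.comap (algebraMap R T)) : Q = Q' := by
  have key : ∀ {Q Q' : Ideal T}, Q.IsPrime → Q'.IsPrime → Q ≠ ⊥ →
      Q.comap (algebraMap R T) = Q'.comap (algebraMap R T) → Q ≤ Q' := by
    intro Q Q' hQ hQ' hQ0 heq q hq
    obtain ⟨s, hs, hsQ⟩ := h.exists_separator Q hQ hQ0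
    obtain ⟨r, hr⟩ := hsQ q hq
    have h1 : r ∈ Q.comap (algebraMap R T) := by
      rw [Ideal.mem_comap, hr]; exact Q.mul_mem_left _ hq
    rw [heq, Ideal.mem_comap, hr] at h1
    refine (hQ'.mem_or_mem h1).resolve_left fun h2 => hs ?_
    have : s ∈ Q'.comap (algebraMap R T) := h2
    rwa [← heq] at this
  exact le_antisymm (key hQ hQ' hQ0 heq) (key hQ' hQ hQ'0 heq.symm)

variable [IsDomain R] [IsDedekindDomain T]

/-- A product of nonzero primes of `T` lies in `cxT`, with `c` in the conductor; contracting to `R`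
lands in `xR` because `cT ⊆ R`. -/
theorem exists_multiset_prod_le (h : IsPseudoDedekind R T) (hR : ¬ IsField R) {x : R}
    (hx : x ≠ 0) : ∃ s : Multiset (Ideal R), s.prod ≤ Ideal.span {x} ∧
      ∀ M ∈ s, ∃ Q : Ideal T, Q.IsPrime ∧ Q ≠ ⊥ ∧ Q.comap (algebraMap R T) = M := by
  obtain ⟨c, hc0, hc⟩ := h.exists_conductor
  have hy : Ideal.span {algebraMap R T (c * x)} ≠ ⊥ := by
    rw [Ne, Ideal.span_singleton_eq_bot, map_eq_zero_iff _ h.injective]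
    exact mul_ne_zero hc0 hx
  obtain ⟨Z, hZ, hZ0⟩ := PrimeSpectrum.exists_primeSpectrum_prod_le_and_ne_bot_of_domain
    (h.not_isField hR) hy
  refine ⟨(Z.map PrimeSpectrum.asIdeal).map (Ideal.comap (algebraMap R T)), ?_, ?_⟩
  · have h1 : ∀ Z : Multiset (Ideal T), (Z.map (Ideal.comap (algebraMap R T))).prod ≤
        Z.prod.comap (algebraMap R T) := by
      intro Z
      induction Z using Multiset.induction_on with
      | empty => simp
      | cons J Z ih =>
        rw [Multiset.map_cons, Multiset.prod_cons, Multiset.prod_cons]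
        exact (Ideal.mul_mono_right ih).trans (Ideal.le_comap_mul _)
    refine (h1 _).trans ((Ideal.comap_mono hZ).trans fun r hr => ?_)
    obtain ⟨t, ht⟩ := Ideal.mem_span_singleton.1 hr
    obtain ⟨r', hr'⟩ := hc t
    refine Ideal.mem_span_singleton.2 ⟨r', h.injective ?_⟩
    rw [ht, map_mul, map_mul, hr']
    ring
  · intro M hM
    obtain ⟨Q, hQ, rfl⟩ := Multiset.mem_map.1 hM
    refine ⟨Q, ?_, ?_, rfl⟩
    · obtain ⟨Q, -, rfl⟩ := Multiset.mem_map.1 hQ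
      exact Q.isPrime
    · rintro rfl
      exact hZ0 (Multiset.prod_eq_zero hQ)

theorem exists_comap_eq (h : IsPseudoDedekind R T) (hR : ¬ IsField R) {P : Ideal R}
    (hP : P.IsPrime) (hP0 : P ≠ ⊥) :
    ∃ Q : Ideal T, Q.IsPrime ∧ Q ≠ ⊥ ∧ Q.comap (algebraMap R T) = P := by
  obtain ⟨x, hx, hx0⟩ := Submodule.exists_mem_ne_zero_of_ne_bot hP0
  obtain ⟨s, hs, hs'⟩ := h.exists_multiset_prod_le hR hx0
  obtain ⟨M, hM, hMP⟩ := (Ideal.IsPrime.multiset_prod_le hP).1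
    (hs.trans (by rwa [Ideal.span_singleton_le_iff_mem]))
  obtain ⟨Q, hQ, hQ0, rfl⟩ := hs' M hM
  exact ⟨Q, hQ, hQ0, (h.isMaximal_comap Q hQ hQ0).eq_of_le hP.ne_top hMP⟩

theorem isMaximal_of_isPrime (h : IsPseudoDedekind R T) (hR : ¬ IsField R) {P : Ideal R}
    (hP : P.IsPrime) (hP0 : P ≠ ⊥) : P.IsMaximal := by
  obtain ⟨Q, hQ, hQ0, rfl⟩ := h.exists_comap_eq hR hP hP0
  exact h.isMaximal_comap Q hQ hQ0

theorem isUnibranched (h : IsPseudoDedekind R T) (hR : ¬ IsField R) :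
    IsUnibranched (algebraMap R T) := by
  refine ⟨h.injective, fun P hP => ?_⟩
  by_cases hP0 : P = ⊥
  · subst hP0
    refine ⟨⊥, ⟨Ideal.isPrime_bot, Ideal.comap_bot_of_injective _ h.injective⟩, ?_⟩
    rintro Q ⟨hQ, hQP⟩
    exact (h.comap_eq_bot_iff hR hQ).1 hQP
  · obtain ⟨Q, hQ, hQ0, rfl⟩ := h.exists_comap_eq hR hP hP0
    refine ⟨Q, ⟨hQ, rfl⟩, ?_⟩
    rintro Q' ⟨hQ', heq⟩
    refine (h.eq_of_comap_eq hQ hQ' hQ0 ?_ heq.symm).symm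
    rintro rfl
    exact hP0 (heq.symm.trans (Ideal.comap_bot_of_injective _ h.injective))

/-- The key to radicality. If the ideal `A` of `r` with `rtT ⊆ R` lay in a maximal ideal `Q ∩ R`,
then `Q` would contain the conductor and hence `t`, and the separator of `Q` would lie in `A`. -/
theorem mem_algebraConductor_of_forall (h : IsPseudoDedekind R T) (hR : ¬ IsField R) {t : T}
    (ht : ∀ Q : Ideal T, Q.IsPrime → algebraConductor R T ≤ Q → t ∈ Q) :
    t ∈ algebraConductor R T := by
  let A : Ideal R :=
    { carrier := {r | ∀ u, ∃ r', algebraMap R T r' = algebraMap R T r * (t * u)}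
      add_mem' := by
        intro a b ha hb u
        obtain ⟨a', ha'⟩ := ha u
        obtain ⟨b', hb'⟩ := hb u
        exact ⟨a' + b', by rw [map_add, map_add, ha', hb', add_mul]⟩
      zero_mem' := fun u => ⟨0, by simp⟩
      smul_mem' := by
        intro r a ha u
        obtain ⟨a', ha'⟩ := ha u
        exact ⟨r * a', by rw [smul_eq_mul, map_mul, map_mul, ha', mul_assoc]⟩ }
  suffices A = ⊤ by
    have h1 : (1 : R) ∈ A := this ▸ trivial
    intro u
    simpa using h1 u
  by_contra hA
  obtain ⟨M, hM, hAM⟩ := Ideal.exists_le_maximal A hA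
  obtain ⟨Q, hQ, hQ0, rfl⟩ := h.exists_comap_eq hR hM.isPrime
    (Ring.ne_bot_of_isMaximal_of_not_isField hM hR)
  have hCQ : algebraConductor R T ≤ Q := by
    intro c hc
    obtain ⟨r, rfl⟩ := exists_algebraMap_eq_of_mem_algebraConductor hc
    exact hAM (show r ∈ A from fun u => hc (t * u))
  obtain ⟨s, hs, hsQ⟩ := h.exists_separator Q hQ hQ0
  exact hs (hAM (show s ∈ A from fun u => hsQ _ (Q.mul_mem_right _ (ht Q hQ hCQ))))

theorem finite_setOf_isPrime_le {I : Ideal T} (hI : I ≠ ⊥) :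
    {Q : Ideal T | Q.IsPrime ∧ I ≤ Q}.Finite := by
  refine (Ideal.finite_minimalPrimes_of_isNoetherianRing T I).subset fun Q hQ => ⟨hQ, ?_⟩
  intro Q' hQ' hle
  exact ((hQ'.1.isMaximal (ne_bot_of_le_ne_bot hI hQ'.2)).eq_of_le hQ.1.ne_top hle).ge

theorem algebraConductor_eq_sInf (h : IsPseudoDedekind R T) (hR : ¬ IsField R) :
    algebraConductor R T = sInf {Q : Ideal T | Q.IsPrime ∧ algebraConductor R T ≤ Q} :=
  le_antisymm (le_sInf fun _ hQ => hQ.2) fun _ ht =>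
    h.mem_algebraConductor_of_forall hR fun _ hQ hCQ => Ideal.mem_sInf.1 ht ⟨hQ, hCQ⟩

theorem isRadical_algebraConductor (h : IsPseudoDedekind R T) (hR : ¬ IsField R) :
    (algebraConductor R T).IsRadical := by
  rintro t ⟨n, hn⟩
  exact h.mem_algebraConductor_of_forall hR fun _ hQ hCQ => hQ.mem_of_pow_mem n (hCQ hn)

theorem isArtinianRing_quotient_algebraConductor (h : IsPseudoDedekind R T) (hR : ¬ IsField R) :
    IsArtinianRing (T ⧸ algebraConductor R T) :=
  Ideal.isArtinianRing_quotient_sInf (finite_setOf_isPrime_le h.algebraConductor_ne_bot)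
    (fun _ hQ => hQ.1.isMaximal (ne_bot_of_le_ne_bot h.algebraConductor_ne_bot hQ.2))
    (h.algebraConductor_eq_sInf hR)

theorem isArtinianRing_quotient_comap (h : IsPseudoDedekind R T) (hR : ¬ IsField R) :
    IsArtinianRing (R ⧸ (algebraConductor R T).comap (algebraMap R T)) := by
  refine Ideal.isArtinianRing_quotient_sInf
    ((finite_setOf_isPrime_le h.algebraConductor_ne_bot).image (Ideal.comap (algebraMap R T))) ?_ ?_
  · rintro _ ⟨Q, hQ, rfl⟩
    exact h.isMaximal_comap Q hQ.1 (ne_bot_of_le_ne_bot h.algebraConductor_ne_bot hQ.2)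
  · nth_rw 1 [h.algebraConductor_eq_sInf hR, Ideal.comap_sInf, sInf_image]

theorem isUnibranched_quotientMap (h : IsPseudoDedekind R T) (hR : ¬ IsField R) :
    IsUnibranched (Ideal.quotientMap (algebraConductor R T) (algebraMap R T)
      (le_refl ((algebraConductor R T).comap (algebraMap R T)))) := by
  refine ⟨Ideal.quotientMap_injective, ?_⟩
  set C := algebraConductor R T
  set f := Ideal.quotientMap C (algebraMap R T) (le_refl (C.comap (algebraMap R T))) with hf
  intro P hP
  have hcomm : f.comp (Ideal.Quotient.mk (C.comap (algebraMap R T))) =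
      (Ideal.Quotient.mk C).comp (algebraMap R T) := by
    ext r; simp [hf]
  have hcomm' : ∀ Q : Ideal (T ⧸ C), (Q.comap f).comap (Ideal.Quotient.mk _) =
      (Q.comap (Ideal.Quotient.mk C)).comap (algebraMap R T) := fun Q => by
    rw [Ideal.comap_comap, Ideal.comap_comap, hcomm]
  have hle : C.comap (algebraMap R T) ≤ P.comap (Ideal.Quotient.mk _) := fun r hr => by
    rw [Ideal.mem_comap, Ideal.Quotient.eq_zero_iff_mem.2 hr]
    exact P.zero_mem
  have hinj : Function.Injective (Ideal.comap (Ideal.Quotient.mk (C.comap (algebraMap R T)))) :=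
    Ideal.comap_injective_of_surjective _ Ideal.Quotient.mk_surjective
  obtain ⟨Q, hQ, hQ0, hQP⟩ := h.exists_comap_eq hR
    (Ideal.IsPrime.comap (K := P) (Ideal.Quotient.mk _))
    (ne_bot_of_le_ne_bot h.comap_algebraConductor_ne_bot hle)
  have hCQ : C ≤ Q := fun c hc => by
    obtain ⟨r, rfl⟩ := exists_algebraMap_eq_of_mem_algebraConductor hc
    have h1 : r ∈ P.comap (Ideal.Quotient.mk _) := hle hc
    rwa [← hQP] at h1
  have hQcm : (Q.map (Ideal.Quotient.mk C)).comap (Ideal.Quotient.mk C) = Q := by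
    rw [Ideal.comap_map_of_surjective _ Ideal.Quotient.mk_surjective, ← RingHom.ker_eq_comap_bot,
      Ideal.mk_ker, sup_eq_left.2 hCQ]
  refine ⟨Q.map (Ideal.Quotient.mk C), ⟨Ideal.map_isPrime_of_surjective
    Ideal.Quotient.mk_surjective (by rwa [Ideal.mk_ker]), hinj ?_⟩, ?_⟩
  · rw [hcomm', hQcm, hQP]
  · rintro Q' ⟨hQ', hQ'P⟩
    refine Ideal.comap_injective_of_surjective _ Ideal.Quotient.mk_surjective ?_
    rw [hQcm]
    refine (h.eq_of_comap_eq hQ (Ideal.IsPrime.comap _) hQ0 ?_ ?_).symm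
    · refine ne_bot_of_le_ne_bot h.algebraConductor_ne_bot fun c hc => ?_
      rw [Ideal.mem_comap, Ideal.Quotient.eq_zero_iff_mem.2 hc]
      exact Q'.zero_mem
    · rw [← hcomm', hQ'P, hQP]

end IsPseudoDedekind

/-! ### Transport of pseudo-Dedekind pairs -/

theorem RingEquiv.isDedekindDomain {A B : Type*} [CommRing A] [CommRing B] (e : A ≃+* B)
    [IsDedekindDomain A] : IsDedekindDomain B :=
  { isNoetherianRing_of_ringEquiv A e, Ring.DimensionLEOne.of_ringEquiv e.symm,
    IsIntegrallyClosed.of_equiv e, e.symm.toMulEquiv.isDomain with }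

namespace IsPseudoDedekind

variable {R T : Type*} [CommRing R] [CommRing T] [Algebra R T]

theorem of_algEquiv (h : IsPseudoDedekind R T) {T' : Type*} [CommRing T'] [Algebra R T']
    (e : T ≃ₐ[R] T') : IsPseudoDedekind R T' := by
  have hbot : ∀ Q : Ideal T', Q ≠ ⊥ → Q.comap (e : T →+* T') ≠ ⊥ := by
    intro Q hQ hbot
    obtain ⟨q, hq, hq0⟩ := Submodule.exists_mem_ne_zero_of_ne_bot hQ
    have h1 : e.symm q ∈ Q.comap (e : T →+* T') := by simpa using hq
    rw [hbot, Ideal.mem_bot] at h1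
    exact hq0 (by simpa using h1)
  refine ⟨?_, ?_, fun Q hQ hQ0 => ?_, fun Q hQ hQ0 => ?_⟩
  · intro a b hab
    rw [← e.commutes, ← e.commutes] at hab
    exact h.injective (e.injective hab)
  · obtain ⟨c, hc0, hc⟩ := h.exists_conductor
    refine ⟨c, hc0, fun t => ?_⟩
    obtain ⟨r, hr⟩ := hc (e.symm t)
    refine ⟨r, ?_⟩
    rw [← e.commutes, hr, map_mul, e.commutes, e.apply_symm_apply]
  · have := h.isMaximal_comap _ (Ideal.IsPrime.comap (e : T →+* T')) (hbot Q hQ0)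
    rw [Ideal.comap_comap] at this
    convert this
    ext r
    simp
  · obtain ⟨s, hs, hs'⟩ := h.exists_separator _ (Ideal.IsPrime.comap (e : T →+* T')) (hbot Q hQ0)
    refine ⟨s, fun hsQ => hs ?_, fun q hq => ?_⟩
    · rw [Ideal.mem_comap]
      simpa using hsQ
    · obtain ⟨r, hr⟩ := hs' (e.symm q) (by simpa using hq)
      refine ⟨r, ?_⟩
      rw [← e.commutes, hr, map_mul, e.commutes, e.apply_symm_apply]

variable [IsDomain R] [IsDedekindDomain T]

/-- The conductor makes `T` almost integral over `R` with the same quotient field. Conversely, an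
element almost integral over `R` is almost integral over `T`, hence integral over it since `T` is
Noetherian, hence in `T`. -/
theorem nonempty_algEquiv_completeIntegralClosure (h : IsPseudoDedekind R T) (K : Type*) [Field K]
    [Algebra R K] [IsFractionRing R K] : Nonempty (T ≃ₐ[R] completeIntegralClosure R K) := by
  obtain ⟨c, hc0, hc⟩ := h.exists_conductor
  let F := FractionRing T
  have hinjF : Function.Injective (algebraMap R F) := by
    rw [IsScalarTower.algebraMap_eq R T F]
    exact (IsFractionRing.injective T F).comp h.injective
  have : FaithfulSMul R F := (faithfulSMul_iff_algebraMap_injective R F).2 hinjF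
  have hcF : algebraMap T F (algebraMap R T c) ≠ 0 := by
    rw [← IsScalarTower.algebraMap_apply, Ne, map_eq_zero_iff _ hinjF]
    exact hc0
  have hfrac : IsFractionRing R F := by
    refine IsFractionRing.of_field R F fun z => ?_
    obtain ⟨a, b, hb, rfl⟩ := IsFractionRing.div_surjective T z
    obtain ⟨x, hx⟩ := hc a
    obtain ⟨y, hy⟩ := hc b
    refine ⟨x, y, ?_⟩
    rw [IsScalarTower.algebraMap_apply R T F, IsScalarTower.algebraMap_apply R T F, hx, hy,
      map_mul, map_mul, mul_div_mul_left _ _ hcF]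
  let e : F ≃ₐ[R] K := IsLocalization.algEquiv (nonZeroDivisors R) F K
  let f : T →ₐ[R] K := e.toAlgHom.comp (IsScalarTower.toAlgHom R T F)
  have hf : ∀ t, f t = e (algebraMap T F t) := fun _ => rfl
  have hfinj : Function.Injective f := e.injective.comp (IsFractionRing.injective T F)
  have hrange : f.range = completeIntegralClosure R K := by
    refine le_antisymm ?_ fun y hy => ?_
    · rintro _ ⟨t, rfl⟩
      refine ⟨c, mem_nonZeroDivisors_of_ne_zero hc0, fun n => ?_⟩
      obtain ⟨r, hr⟩ := hc (t ^ n)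
      refine ⟨r, ?_⟩
      rw [← f.commutes, hr, map_mul, f.commutes, map_pow, Algebra.smul_def]
      rfl
    · obtain ⟨r, hr, hy⟩ := hy
      have hr0 : r ≠ 0 := nonZeroDivisors.ne_zero hr
      have h1 : IsAlmostIntegral T (e.symm y) := by
        refine ⟨algebraMap R T r, mem_nonZeroDivisors_of_ne_zero ?_, fun n => ?_⟩
        · rwa [Ne, map_eq_zero_iff _ h.injective]
        · obtain ⟨a, ha⟩ := hy n
          refine ⟨algebraMap R T a, ?_⟩
          rw [Algebra.smul_def, ← IsScalarTower.algebraMap_apply, ← IsScalarTower.algebraMap_apply,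
            ← e.symm.commutes, ha, ← Algebra.smul_def, map_smul, map_pow]
      obtain ⟨t, ht⟩ := IsIntegrallyClosed.isIntegral_iff.1 (isAlmostIntegral_iff_isIntegral.1 h1)
      exact ⟨t, by change f t = y; rw [hf, ht, e.apply_symm_apply]⟩
  exact ⟨(AlgEquiv.ofInjective f hfinj).trans (Subalgebra.equivOfEq _ _ hrange)⟩

theorem completeIntegralClosure (h : IsPseudoDedekind R T) (K : Type*) [Field K]
    [Algebra R K] [IsFractionRing R K] : IsDedekindDomain (completeIntegralClosure R K) ∧
      IsPseudoDedekind R (_root_.completeIntegralClosure R K) := by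
  obtain ⟨e⟩ := h.nonempty_algEquiv_completeIntegralClosure K
  exact ⟨e.toRingEquiv.isDedekindDomain, h.of_algEquiv e⟩

end IsPseudoDedekind

/-! ### Factorization into two-absorbing ideals -/

/-- Elements outside `M` are units modulo `J`, so a factor outside `M` may be dropped; a product of
two factors inside `M` is in `M² ⊆ J`. -/
theorem IsTwoAbsorbing.of_isMaximal_of_pow_two_le {R : Type*} [CommRing R] {M J : Ideal R}
    (hM : M.IsMaximal) (hJM : J ≤ M) (hMJ : M ^ 2 ≤ J) : IsTwoAbsorbing J := by
  have key : ∀ x y : R, x ∉ M → x * y ∈ J → y ∈ J := by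
    intro x y hx hxy
    obtain ⟨u, m, hm, hum⟩ := hM.exists_inv hx
    have h2 : y ∈ M := by
      refine (hM.isPrime.mem_or_mem (hJM hxy)).resolve_left hx
    have : y = u * (x * y) + m * y := by linear_combination (-y) * hum
    rw [this]
    refine J.add_mem (J.mul_mem_left _ hxy) (hMJ ?_)
    rw [pow_two]
    exact Ideal.mul_mem_mul hm h2
  intro a b c h
  by_cases ha : a ∈ M
  · by_cases hb : b ∈ M
    · exact Or.inl (hMJ (by rw [pow_two]; exact Ideal.mul_mem_mul ha hb))
    · exact Or.inr (Or.inl (key b _ hb (by convert h using 1; ring)))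
  · exact Or.inr (Or.inr (key a _ ha (by convert h using 1; ring)))

/-- An ideal between `M ^ (n + 1)` and `M ^ n` is a product of two-absorbing ideals, if `x ∈ M`
is such that `M ^ 2 ≤ x M + M ^ n` for all `n`. -/
theorem Ideal.exists_isTwoAbsorbing_factors_of_le_of_le {R : Type*} [CommRing R] {M : Ideal R}
    (hM : M.IsMaximal) {x : R} (hx : x ∈ M)
    (hxM : M ^ 2 ≤ Ideal.span {x} * M ⊔ M ^ 3) {n : ℕ} {I : Ideal R}
    (h₁ : M ^ (n + 2) ≤ I) (h₂ : I ≤ M ^ (n + 1)) :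
    ∃ s : Multiset (Ideal R), (∀ J ∈ s, IsTwoAbsorbing J) ∧ s.prod = I := by
  have hstep : ∀ k, M ^ (k + 2) ≤ Ideal.span {x} * M ^ (k + 1) ⊔ M ^ (k + 3) := by
    intro k
    calc M ^ (k + 2) = M ^ k * M ^ 2 := by rw [pow_add]
      _ ≤ M ^ k * (Ideal.span {x} * M ⊔ M ^ 3) := Ideal.mul_mono_right hxM
      _ = Ideal.span {x} * M ^ (k + 1) ⊔ M ^ (k + 3) := by
        rw [Ideal.mul_sup, mul_left_comm, ← pow_succ, ← pow_add]
  induction n generalizing I with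
  | zero =>
    refine ⟨{I}, ?_, by simp⟩
    simp only [Multiset.mem_singleton, forall_eq]
    exact IsTwoAbsorbing.of_isMaximal_of_pow_two_le hM (by simpa using h₂) (by simpa using h₁)
  | succ n ih =>
    -- `I'` is the part of `I : x` inside `M^(n+1)`. It satisfies the hypotheses one level lower,
    -- and `I = ((x) + M²) I'`, whose first factor is 2-absorbing.
    let I' : Ideal R := M ^ (n + 1) ⊓ Submodule.comap (LinearMap.mulLeft R x) I
    have hI' : ∀ z, z ∈ I' ↔ z ∈ M ^ (n + 1) ∧ x * z ∈ I := fun _ => Iff.rfl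
    have hle : M ^ (n + 2) ≤ I' := fun z hz => by
      refine (hI' z).2 ⟨Ideal.pow_le_pow_right (by omega) hz, h₁ ?_⟩
      rw [add_right_comm, pow_succ']
      exact Ideal.mul_mem_mul hx hz
    obtain ⟨s, hs, hprod⟩ := ih hle inf_le_left
    have hJ : IsTwoAbsorbing (Ideal.span {x} ⊔ M ^ 2) :=
      IsTwoAbsorbing.of_isMaximal_of_pow_two_le hM (sup_le
        (by rwa [Ideal.span_singleton_le_iff_mem]) (Ideal.pow_le_self two_ne_zero)) le_sup_right
    refine ⟨(Ideal.span {x} ⊔ M ^ 2) ::ₘ s, ?_, ?_⟩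
    · simp only [Multiset.mem_cons]
      rintro J (rfl | hJs)
      exacts [hJ, hs J hJs]
    have hbig : M ^ (n + 3) ≤ (Ideal.span {x} ⊔ M ^ 2) * I' := by
      refine (hstep (n + 1)).trans (sup_le (Ideal.mul_mono le_sup_left hle) ?_)
      calc M ^ (n + 1 + 3) = M ^ 2 * M ^ (n + 2) := by rw [← pow_add]; congr 1; omega
        _ ≤ _ := Ideal.mul_mono le_sup_right hle
    rw [Multiset.prod_cons, hprod]
    refine le_antisymm ?_ fun y hy => ?_
    · rw [Ideal.sup_mul]
      refine sup_le ?_ ?_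
      · rw [Ideal.span_singleton_mul_le_iff]
        exact fun z hz => ((hI' z).1 hz).2
      · refine le_trans ?_ h₁
        calc M ^ 2 * I' ≤ M ^ 2 * M ^ (n + 1) := Ideal.mul_mono_right inf_le_left
          _ = _ := by rw [← pow_add]; congr 1; omega
    · obtain ⟨p, hp, w, hw, rfl⟩ := Submodule.mem_sup.1 (hstep n (h₂ hy))
      obtain ⟨z, hz, rfl⟩ := Ideal.mem_span_singleton_mul.1 hp
      refine Ideal.add_mem _ (Ideal.mul_mem_mul (Ideal.mem_sup_left
        (Ideal.mem_span_singleton_self x)) ((hI' z).2 ⟨hz, ?_⟩)) (hbig hw)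
      exact (I.add_mem_iff_left (h₁ hw)).1 hy

/-- If `M ^ 2 ≤ x M + M ^ 3` for all `x ∈ M \ M ^ 2`, then every `M`-primary ideal that contains
a power of `M` is a product of two-absorbing ideals. -/
theorem Ideal.exists_isTwoAbsorbing_factors_of_pow_le {R : Type*} [CommRing R] {M : Ideal R}
    (hM : M.IsMaximal) (hxM : ∀ x ∈ M, x ∉ M ^ 2 → M ^ 2 ≤ Ideal.span {x} * M ⊔ M ^ 3) {e : ℕ}
    {I : Ideal R} (h₁ : M ^ e ≤ I) (h₂ : I ≤ M) :
    ∃ s : Multiset (Ideal R), (∀ J ∈ s, IsTwoAbsorbing J) ∧ s.prod = I := by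
  classical
  have hMabs : IsTwoAbsorbing M :=
    IsTwoAbsorbing.of_isMaximal_of_pow_two_le hM le_rfl (Ideal.pow_le_self two_ne_zero)
  by_cases hIe : I ≤ M ^ e
  · refine ⟨Multiset.replicate e M, fun J hJ => (Multiset.eq_of_mem_replicate hJ) ▸ hMabs, ?_⟩
    rw [Multiset.prod_replicate]
    exact le_antisymm h₁ hIe
  have hex : ∃ k, ¬ I ≤ M ^ k := ⟨e, hIe⟩
  -- The values 0 and 1 are excluded by `M^0 = R` and `I ⊆ M`, so `I ⊆ M^(n+1)` but not `I ⊆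
  -- M^(n+2)`.
  obtain ⟨n, hn⟩ : ∃ n, Nat.find hex = n + 2 := by
    have h0 : Nat.find hex ≠ 0 := fun h0 => Nat.find_spec hex (by rw [h0]; simp)
    have h1 : Nat.find hex ≠ 1 := fun h1 => Nat.find_spec hex (by rw [h1]; simpa)
    exact ⟨Nat.find hex - 2, by omega⟩
  have hle : I ≤ M ^ (n + 1) := not_not.1 (Nat.find_min hex (m := n + 1) (by omega))
  have hnot : ¬ I ≤ M ^ (n + 2) := hn ▸ Nat.find_spec hex
  obtain ⟨y, hyI, hy⟩ := SetLike.not_le_iff_exists.1 hnot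
  obtain ⟨x, hx, hx2⟩ : ∃ x ∈ M, x ∉ M ^ 2 := by
    by_contra! hcon
    have hMM : M ^ 2 = M := le_antisymm (Ideal.pow_le_self two_ne_zero) hcon
    refine hnot (hle.trans ?_)
    rw [pow_add M n 2, hMM, pow_succ]
  have hstep : ∀ x ∈ M, x ∉ M ^ 2 → ∀ k,
      M ^ (k + 2) ≤ Ideal.span {x} * M ^ (k + 1) ⊔ M ^ (k + 3) := by
    intro x hx hx2 k
    calc M ^ (k + 2) = M ^ k * M ^ 2 := by rw [pow_add]
      _ ≤ M ^ k * (Ideal.span {x} * M ⊔ M ^ 3) := Ideal.mul_mono_right (hxM x hx hx2)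
      _ = Ideal.span {x} * M ^ (k + 1) ⊔ M ^ (k + 3) := by
        rw [Ideal.mul_sup, mul_left_comm, ← pow_succ, ← pow_add]
  have hpow : ∀ k, M ^ (k + 1) ≤ Ideal.span {x ^ k} * M ⊔ M ^ (k + 2) := by
    intro k
    induction k with
    | zero => simp
    | succ k ih =>
      refine (hstep x hx hx2 k).trans (sup_le ?_ le_sup_right)
      refine (Ideal.mul_mono_right ih).trans ?_
      rw [Ideal.mul_sup, ← mul_assoc, Ideal.span_singleton_mul_span_singleton, ← pow_succ']
      refine sup_le_sup_left ?_ _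
      rw [show k + 1 + 2 = (k + 2) + 1 by omega, pow_succ' M (k + 2)]
      exact Ideal.mul_mono_left (by rwa [Ideal.span_singleton_le_iff_mem])
  -- the element `y` of `I` already generates `M ^ (n + 2)` up to higher powers
  obtain ⟨p, hp, w, hw, rfl⟩ := Submodule.mem_sup.1 (hpow n (hle hyI))
  obtain ⟨z, hz, rfl⟩ := Ideal.mem_span_singleton_mul.1 hp
  have hz2 : z ∉ M ^ 2 := fun hz2 => hy (Ideal.add_mem _ (by
    rw [pow_add]
    exact Ideal.mul_mem_mul (Ideal.pow_mem_pow hx n) hz2) hw)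
  have hgen : M ^ (n + 2) ≤ I ⊔ M ^ (n + 3) := by
    have h3 : M ^ (n + 2) ≤ Ideal.span {x ^ n * z} * M ⊔ M ^ (n + 3) := by
      have h4 : M ^ (n + 2) ≤ Ideal.span {x ^ n} * M ^ 2 ⊔ M ^ (n + 3) := by
        calc M ^ (n + 2) = M ^ (n + 1) * M := pow_succ _ _
          _ ≤ (Ideal.span {x ^ n} * M ⊔ M ^ (n + 2)) * M := Ideal.mul_mono_left (hpow n)
          _ = _ := by rw [Ideal.sup_mul, mul_assoc, ← pow_two, ← pow_succ]
      refine h4.trans (sup_le ?_ le_sup_right)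
      refine (Ideal.mul_mono_right (hxM z hz hz2)).trans ?_
      rw [Ideal.mul_sup, ← mul_assoc, Ideal.span_singleton_mul_span_singleton, pow_add M n 3]
      exact sup_le_sup_left (Ideal.mul_mono_left (by
        rw [Ideal.span_singleton_le_iff_mem]; exact Ideal.pow_mem_pow hx n)) _
    refine h3.trans (sup_le ?_ le_sup_right)
    rw [Ideal.span_singleton_mul_le_iff]
    intro m hm
    have : x ^ n * z * m = (x ^ n * z + w) * m + -(w * m) := by ring
    rw [this]
    refine Ideal.add_mem _ (Ideal.mem_sup_left (I.mul_mem_right _ hyI))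
      (Ideal.mem_sup_right (neg_mem ?_))
    rw [pow_succ]
    exact Ideal.mul_mem_mul hw hm
  -- The inclusion `M^(n+2) ⊆ I + M^(n+3)` is iterated until the exponent exceeds `e`; the
  -- hypothesis `M^e ⊆ I` thus replaces Nakayama.
  have hall : ∀ k, M ^ (n + 2) ≤ I ⊔ M ^ (n + 2 + k) := by
    intro k
    induction k with
    | zero => exact le_sup_right
    | succ k ih =>
      refine ih.trans (sup_le le_sup_left ?_)
      calc M ^ (n + 2 + k) = M ^ (n + 2) * M ^ k := pow_add _ _ _
        _ ≤ (I ⊔ M ^ (n + 3)) * M ^ k := Ideal.mul_mono_left hgen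
        _ = I * M ^ k ⊔ M ^ (n + 2 + (k + 1)) := by
          rw [Ideal.sup_mul, ← pow_add]; congr 2; omega
        _ ≤ _ := sup_le_sup_right Ideal.mul_le_left _
  have hfin : M ^ (n + 2) ≤ I :=
    (hall e).trans (sup_le le_rfl ((Ideal.pow_le_pow_right (by omega)).trans h₁))
  exact Ideal.exists_isTwoAbsorbing_factors_of_le_of_le hM hx (hxM x hx hx2) hfin hle

theorem Ideal.prod_sup_eq_of_pairwise_isCoprime {R ι : Type*} [CommRing R] {s : Finset ι}
    {f : ι → Ideal R} {I : Ideal R} (hf : (s : Set ι).Pairwise (Function.onFun IsCoprime f))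
    (hI : ∏ i ∈ s, f i ≤ I) : ∏ i ∈ s, (I ⊔ f i) = I := by
  classical
  refine le_antisymm ?_ ?_
  · have : ∏ i ∈ s, (I ⊔ f i) ≤ I ⊔ ∏ i ∈ s, f i := by
      clear hI hf
      induction s using Finset.induction_on with
      | empty => simp
      | insert i s hi ih =>
        rw [Finset.prod_insert hi, Finset.prod_insert hi]
        refine (Ideal.mul_mono_right ih).trans ?_
        rw [Ideal.sup_mul, Ideal.mul_sup (f i)]
        exact sup_le (Ideal.mul_le_left.trans le_sup_left)
          (sup_le (Ideal.mul_le_right.trans le_sup_left) le_sup_right)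
    exact this.trans (sup_le le_rfl hI)
  · rw [Ideal.prod_eq_iInf_of_pairwise_isCoprime]
    · exact le_iInf₂ fun i _ => le_sup_left
    · intro i hi j hj hij
      have := hf hi hj hij
      simp only [Function.onFun, Ideal.isCoprime_iff_sup_eq] at this ⊢
      exact top_unique (this.ge.trans (sup_le_sup le_sup_right le_sup_right))

/-! ### Pseudo-Dedekind pairs give TAF-rings -/

namespace IsPseudoDedekind

variable {R T : Type*} [CommRing R] [CommRing T] [Algebra R T]

/-- The identity `Q² = xQ + Q³` of the Dedekind domain is pulled down to `R`: multiplication by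
`s^k` carries `Q^k` into `M^k`, and `s` is invertible modulo `M`. -/
theorem sq_le_span_mul_sup [IsDedekindDomain T] (h : IsPseudoDedekind R T) {Q : Ideal T}
    (hQ : Q.IsPrime) (hQ0 : Q ≠ ⊥) {M : Ideal R} (hQM : Q.comap (algebraMap R T) = M) {x : R}
    (hx : x ∈ M) (hx2 : x ∉ M ^ 2) : M ^ 2 ≤ Ideal.span {x} * M ⊔ M ^ 3 := by
  have hM : M.IsMaximal := hQM ▸ h.isMaximal_comap Q hQ hQ0
  obtain ⟨s, hs, hs'⟩ := h.exists_separator Q hQ hQ0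
  have hsM : s ∉ M := fun hsM => hs (by rwa [← hQM] at hsM)
  have hmem : ∀ r : R, r ∈ M ↔ algebraMap R T r ∈ Q := fun r => by rw [← hQM]; rfl
  have hlift : ∀ k, ∀ q ∈ Q ^ (k + 1), ∃ r ∈ M ^ (k + 1),
      algebraMap R T r = algebraMap R T s ^ (k + 1) * q := by
    intro k
    induction k with
    | zero =>
      intro q hq
      simp only [zero_add, pow_one] at hq ⊢
      obtain ⟨r, hr⟩ := hs' q hq
      exact ⟨r, (hmem r).2 (hr ▸ Q.mul_mem_left _ hq), hr⟩
    | succ k ih =>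
      intro q hq
      rw [pow_succ] at hq
      refine Submodule.mul_induction_on hq (fun a ha b hb => ?_) ?_
      · obtain ⟨r, hr, hra⟩ := ih a ha
        obtain ⟨t, ht⟩ := hs' b hb
        refine ⟨r * t, ?_, ?_⟩
        · rw [pow_succ]
          exact Ideal.mul_mem_mul hr ((hmem t).2 (ht ▸ Q.mul_mem_left _ hb))
        · rw [map_mul, hra, ht]; ring
      · rintro a b ⟨r, hr, hra⟩ ⟨t, ht, htb⟩
        exact ⟨r + t, Ideal.add_mem _ hr ht, by rw [map_add, hra, htb, mul_add]⟩
  have hinv : ∀ k, ∃ u, ∃ m ∈ M, u * s ^ k + m = 1 := fun k =>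
    hM.exists_inv fun h => hsM (hM.isPrime.mem_of_pow_mem k h)
  have hxQ2 : algebraMap R T x ∉ Q ^ 2 := by
    intro hxQ
    obtain ⟨r, hr, hrx⟩ := hlift 1 _ hxQ
    obtain ⟨u, m, hm, hum⟩ := hinv 2
    rw [← map_pow, ← map_mul] at hrx
    have hrx' := h.injective hrx
    refine hx2 ?_
    have : x = u * r + m * x := by
      rw [hrx']; linear_combination (-x) * hum
    rw [this]
    refine Ideal.add_mem _ (Ideal.mul_mem_left _ _ hr) ?_
    rw [pow_two]
    exact Ideal.mul_mem_mul hm hx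
  have hQ2 : Q ^ 2 ≤ Ideal.span {algebraMap R T x} * Q ⊔ Q ^ 3 := by
    -- No ideal of `T` lies strictly between `Q²` and `Q`, and `x ∉ Q²`.
    have hQx : Ideal.span {algebraMap R T x} ⊔ Q ^ 2 = Q := by
      have := Ideal.eq_prime_pow_of_succ_lt_of_le (P := Q) hQ0 (i := 1)
        (I := Ideal.span {algebraMap R T x} ⊔ Q ^ 2)
        (lt_of_le_of_ne le_sup_right fun h => hxQ2
          (h ▸ Ideal.mem_sup_left (Ideal.mem_span_singleton_self _)))
        (by
          rw [pow_one]
          exact sup_le (by rw [Ideal.span_singleton_le_iff_mem]; exact (hmem x).1 hx)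
            (Ideal.pow_le_self two_ne_zero))
      rwa [pow_one] at this
    refine le_of_eq ?_
    calc Q ^ 2 = (Ideal.span {algebraMap R T x} ⊔ Q ^ 2) * Q := by rw [hQx, pow_two]
      _ = _ := by rw [Ideal.sup_mul, ← pow_succ]
  intro m hm
  have hmQ : algebraMap R T m ∈ Q ^ 2 := by
    have h1 := Ideal.mem_map_of_mem (algebraMap R T) hm
    rw [Ideal.map_pow] at h1
    exact Ideal.pow_right_mono (Ideal.map_le_iff_le_comap.2 hQM.ge) 2 h1
  obtain ⟨p, hp, w, hw, hpw⟩ := Submodule.mem_sup.1 (hQ2 hmQ)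
  obtain ⟨q, hq, rfl⟩ := Ideal.mem_span_singleton_mul.1 hp
  obtain ⟨r₁, hr₁, hr₁q⟩ := hlift 0 q (by simpa using hq)
  obtain ⟨r₂, hr₂, hr₂w⟩ := hlift 2 w hw
  obtain ⟨u, n, hn, hun⟩ := hinv 3
  have heq : s ^ 3 * m = x * (s ^ 2 * r₁) + r₂ := h.injective (by
    simp only [map_mul, map_add, map_pow, hr₁q, hr₂w, ← hpw]; ring)
  have : m = x * (u * (s ^ 2 * r₁)) + (u * r₂ + n * m) := by
    linear_combination (-m) * hun + u * heq
  rw [this]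
  refine Ideal.add_mem _ (Ideal.mem_sup_left (Ideal.mem_span_singleton_mul.2
    ⟨_, Ideal.mul_mem_left _ _ (Ideal.mul_mem_left _ _ (by simpa using hr₁)), rfl⟩))
    (Ideal.mem_sup_right (Ideal.add_mem _ (Ideal.mul_mem_left _ _ hr₂) ?_))
  rw [show 3 = 1 + 2 from rfl, pow_add, pow_one]
  exact Ideal.mul_mem_mul hn hm

theorem isTAFRing [IsDomain R] [IsDedekindDomain T] (h : IsPseudoDedekind R T)
    (hR : ¬ IsField R) : IsTAFRing R := by
  classical
  intro I hI
  by_cases hI0 : I = ⊥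
  · refine ⟨{⊥}, ?_, by simp [hI0]⟩
    simp only [Multiset.mem_singleton, forall_eq]
    intro a b c habc
    rw [Ideal.mem_bot, mul_eq_zero, mul_eq_zero] at habc
    rcases habc with (rfl | rfl) | rfl <;> simp
  obtain ⟨x, hx, hx0⟩ := Submodule.exists_mem_ne_zero_of_ne_bot hI0
  obtain ⟨s, hs, hsmax⟩ := h.exists_multiset_prod_le hR hx0
  replace hs : s.prod ≤ I := hs.trans (by rwa [Ideal.span_singleton_le_iff_mem])
  have hmax : ∀ M ∈ s.toFinset, M.IsMaximal := by
    intro M hM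
    obtain ⟨Q, hQ, hQ0, rfl⟩ := hsmax M (Multiset.mem_toFinset.1 hM)
    exact h.isMaximal_comap Q hQ hQ0
  rw [Finset.prod_multiset_count] at hs
  have hprod := Ideal.prod_sup_eq_of_pairwise_isCoprime (fun M hM N hN hne => by
    have := hmax M hM
    have := hmax N hN
    exact (Ideal.isCoprime_of_isMaximal hne).pow) hs
  have hex : ∀ M ∈ s.toFinset, ∃ t : Multiset (Ideal R), (∀ J ∈ t, IsTwoAbsorbing J) ∧
      t.prod = I ⊔ M ^ s.count M := by
    intro M hM
    by_cases htop : I ⊔ M ^ s.count M = ⊤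
    · exact ⟨0, by simp, by simp [htop]⟩
    obtain ⟨N, hN, hle⟩ := Ideal.exists_le_maximal _ htop
    have hMN : M = N := (hmax M hM).eq_of_le hN.ne_top
      fun m hm => hN.isPrime.mem_of_pow_mem _ (hle (Ideal.mem_sup_right (Ideal.pow_mem_pow hm _)))
    obtain ⟨Q, hQ, hQ0, hQM⟩ := hsmax M (Multiset.mem_toFinset.1 hM)
    exact Ideal.exists_isTwoAbsorbing_factors_of_pow_le (hmax M hM)
      (fun x hx hx2 => h.sq_le_span_mul_sup hQ hQ0 hQM hx hx2) le_sup_right (hMN ▸ hle)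
  choose! t ht htp using hex
  refine ⟨∑ M ∈ s.toFinset, t M, fun J hJ => ?_, ?_⟩
  · obtain ⟨M, hM, hJM⟩ := Multiset.mem_sum.1 hJ
    exact ht M hM J hJM
  · rw [Multiset.prod_sum, ← hprod]
    exact Finset.prod_congr rfl htp

end IsPseudoDedekind

/-! ### A criterion by a common radical ideal -/

namespace IsPseudoDedekind

variable {R T : Type*} [CommRing R] [CommRing T] [Algebra R T] [IsDedekindDomain T]

/-- At a prime not containing `B`, an element of `B` outside it multiplies all of `T` into `R`. The
primes containing `B` are finitely many, and there radicality of `B` supplies the separator. -/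
theorem of_isRadical (hinj : Function.Injective (algebraMap R T)) {B : Ideal T} (hB0 : B ≠ ⊥)
    (hBrad : B.IsRadical) (hB : ∀ b ∈ B, ∃ r, algebraMap R T r = b)
    (hmax : ∀ Q : Ideal T, Q.IsPrime → B ≤ Q → (Q.comap (algebraMap R T)).IsMaximal)
    (huniq : ∀ Q Q' : Ideal T, Q.IsPrime → Q'.IsPrime → B ≤ Q → B ≤ Q' →
      Q.comap (algebraMap R T) = Q'.comap (algebraMap R T) → Q = Q') :
    IsPseudoDedekind R T := by
  classical
  refine ⟨hinj, ?_, fun Q hQ hQ0 => ?_, fun Q hQ hQ0 => ?_⟩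
  · obtain ⟨b, hb, hb0⟩ := Submodule.exists_mem_ne_zero_of_ne_bot hB0
    obtain ⟨c, rfl⟩ := hB b hb
    exact ⟨c, by rintro rfl; simp at hb0, fun t => hB _ (B.mul_mem_right _ hb)⟩
  · by_cases hBQ : B ≤ Q
    · exact hmax Q hQ hBQ
    obtain ⟨b, hb, hbQ⟩ := SetLike.not_le_iff_exists.1 hBQ
    obtain ⟨c, rfl⟩ := hB b hb
    have hQmax := hQ.isMaximal hQ0
    rw [Ideal.isMaximal_iff]
    refine ⟨fun h1 => hQ.ne_top ((Ideal.eq_top_iff_one _).2 (by simpa using h1)), ?_⟩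
    intro J x hJ hx hxJ
    have hcx : algebraMap R T c * algebraMap R T c * algebraMap R T x ∉ Q := fun h =>
      (hQ.mem_or_mem h).elim (fun h => (hQ.mem_or_mem h).elim hbQ hbQ) hx
    obtain ⟨u, m, hm, hum⟩ := hQmax.exists_inv hcx
    -- The inverse `u` modulo `Q` need not lie in `R`, but `cu` does.
    obtain ⟨y, hy⟩ := hB _ (B.mul_mem_right u hb)
    have h1 : 1 - c * y * x ∈ J := hJ (by
      rw [Ideal.mem_comap]
      convert hm using 1
      simp only [map_sub, map_mul, map_one, hy]
      linear_combination -hum)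
    have := J.add_mem h1 (J.mul_mem_left (c * y) hxJ)
    rwa [sub_add_cancel] at this
  · by_cases hBQ : B ≤ Q
    · have hfin := finite_setOf_isPrime_le hB0
      have hex : ∀ Q' : Ideal T, ∃ t, algebraMap R T t ∉ Q ∧
          (Q'.IsPrime → B ≤ Q' → Q' ≠ Q → algebraMap R T t ∈ Q') := by
        intro Q'
        by_cases hQ' : Q'.IsPrime ∧ B ≤ Q' ∧ Q' ≠ Q
        · obtain ⟨h1, h2, h3⟩ := hQ'
          by_contra! hcon
          refine h3 (huniq _ _ h1 hQ h2 hBQ ((hmax _ h1 h2).eq_of_le (hmax _ hQ hBQ).ne_top ?_))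
          intro t ht
          by_contra htQ
          exact (hcon t htQ).2.2.2 ht
        · refine ⟨1, fun h1 => hQ.ne_top ((Ideal.eq_top_iff_one _).2 (by simpa using h1)), ?_⟩
          exact fun h1 h2 h3 => (hQ' ⟨h1, h2, h3⟩).elim
      choose t ht ht' using hex
      -- The product lies in every other prime over `B`, so its multiple by `q ∈ Q` lies in all
      -- primes over `B`, hence in `B ⊆ R`.
      refine ⟨∏ Q' ∈ hfin.toFinset, t Q', fun h => ?_, fun q hq => hB _ (hBrad ?_)⟩
      · rw [map_prod] at h
        obtain ⟨Q', -, hQ'⟩ := hQ.prod_mem_iff.1 h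
        exact ht Q' hQ'
      · rw [Ideal.radical_eq_sInf, Ideal.mem_sInf]
        rintro Q' ⟨hBQ', hQ'⟩
        by_cases hne : Q' = Q
        · exact hne ▸ Q.mul_mem_left _ hq
        · refine Ideal.mul_mem_right _ _ ?_
          rw [map_prod]
          exact Ideal.mem_of_dvd _ (Finset.dvd_prod_of_mem (fun Q' => algebraMap R T (t Q'))
            (hfin.mem_toFinset.2 ⟨hQ', hBQ'⟩)) (ht' Q' hQ' hBQ' hne)
    · obtain ⟨b, hb, hbQ⟩ := SetLike.not_le_iff_exists.1 hBQ
      obtain ⟨c, rfl⟩ := hB b hb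
      exact ⟨c, hbQ, fun q _ => hB _ (B.mul_mem_right _ hb)⟩

/-! ### Pullbacks -/

theorem of_pullbackSubring (hR : ¬ IsField R) (hinj : Function.Injective (algebraMap R T))
    {n : ℕ} {N : Fin n → Ideal T} {k : ∀ i, Subring (T ⧸ N i)} (hN : ∀ i, (N i).IsMaximal)
    (hNinj : Function.Injective N) (hk : ∀ i, IsField (k i))
    (hrange : (algebraMap R T).range = pullbackSubring N k) : IsPseudoDedekind R T := by
  classical
  have hmem : ∀ t : T, (∃ r, algebraMap R T r = t) ↔ ∀ i, Ideal.Quotient.mk (N i) t ∈ k i := by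
    intro t
    rw [← mem_pullbackSubring, ← hrange, RingHom.mem_range]
  have hcop : Pairwise (Function.onFun IsCoprime N) := fun i j hij => by
    have := hN i
    have := hN j
    exact Ideal.isCoprime_of_isMaximal fun h => hij (hNinj h)
  -- By the Chinese remainder theorem each `w ∈ k i` lifts to an element of `T` vanishing modulo the
  -- other `N j`; such an element satisfies all the pullback conditions.
  have hlift : ∀ i, ∀ w ∈ k i, ∃ r, Ideal.Quotient.mk (N i) (algebraMap R T r) = w ∧
      ∀ j, j ≠ i → algebraMap R T r ∈ N j := by
    intro i w hw
    obtain ⟨v, rfl⟩ := Ideal.Quotient.mk_surjective w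
    obtain ⟨t, ht⟩ := Ideal.exists_forall_sub_mem_ideal hcop (fun j => if j = i then v else 0)
    have hti : Ideal.Quotient.mk (N i) t = Ideal.Quotient.mk (N i) v :=
      Ideal.Quotient.eq.2 (by simpa using ht i)
    have htj : ∀ j, j ≠ i → t ∈ N j := fun j hj => by simpa [hj] using ht j
    obtain ⟨r, rfl⟩ := (hmem t).2 fun j => by
      by_cases hj : j = i
      · subst hj
        rwa [hti]
      · rw [Ideal.Quotient.eq_zero_iff_mem.2 (htj j hj)]
        exact (k j).zero_mem
    exact ⟨r, hti, htj⟩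
  have hmax : ∀ i, ((N i).comap (algebraMap R T)).IsMaximal := by
    intro i
    rw [Ideal.isMaximal_iff]
    refine ⟨fun h1 => (hN i).ne_top ((Ideal.eq_top_iff_one _).2 (by simpa using h1)), ?_⟩
    intro J x hJ hx hxJ
    have hxk := (hmem (algebraMap R T x)).1 ⟨x, rfl⟩ i
    have hx0 : (⟨_, hxk⟩ : k i) ≠ 0 := by
      rw [Ne, Subtype.ext_iff]
      exact fun h => hx (Ideal.mem_comap.2 (Ideal.Quotient.eq_zero_iff_mem.1 h))
    obtain ⟨w, hw⟩ := (hk i).mul_inv_cancel hx0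
    obtain ⟨r, hr, -⟩ := hlift i w w.2
    have h1 : x * r - 1 ∈ (N i).comap (algebraMap R T) := by
      rw [Ideal.mem_comap, ← Ideal.Quotient.eq_zero_iff_mem, map_sub, map_mul, map_sub, map_mul,
        hr, map_one, map_one, sub_eq_zero]
      exact congrArg Subtype.val hw
    have := J.sub_mem (J.mul_mem_right r hxJ) (hJ h1)
    rwa [sub_sub_cancel] at this
  have hN0 : ∀ i, N i ≠ ⊥ := by
    intro i hi
    have hfield : IsField T := Ring.isField_iff_maximal_bot.2 (hi ▸ hN i)
    have hbot : ((N i).comap (algebraMap R T)) = ⊥ := by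
      rw [hi]; exact Ideal.comap_bot_of_injective _ hinj
    have := hinj.isDomain
    exact Ring.ne_bot_of_isMaximal_of_not_isField (hmax i) hR hbot
  have hle : ∀ Q : Ideal T, Q.IsPrime → ⨅ i, N i ≤ Q → ∃ i, Q = N i := by
    intro Q hQ hQle
    have : Finset.univ.inf N ≤ Q := by rwa [Finset.inf_univ_eq_iInf]
    obtain ⟨i, -, hi⟩ := (Ideal.IsPrime.inf_le' hQ).1 this
    exact ⟨i, ((hN i).eq_of_le hQ.ne_top hi).symm⟩
  refine of_isRadical hinj (B := ⨅ i, N i) ?_ ?_ ?_ ?_ ?_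
  · have hprod : ∏ i, N i ≠ ⊥ := Finset.prod_ne_zero_iff.2 fun i _ => hN0 i
    refine ne_bot_of_le_ne_bot hprod (le_iInf fun i => ?_)
    exact Ideal.le_of_dvd (Finset.dvd_prod_of_mem N (Finset.mem_univ i))
  · rintro t ⟨m, hm⟩
    rw [Ideal.mem_iInf] at hm ⊢
    exact fun i => (hN i).isPrime.mem_of_pow_mem m (hm i)
  · intro b hb
    rw [Ideal.mem_iInf] at hb
    refine (hmem b).2 fun i => ?_
    rw [Ideal.Quotient.eq_zero_iff_mem.2 (hb i)]
    exact (k i).zero_mem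
  · intro Q hQ hQle
    obtain ⟨i, rfl⟩ := hle Q hQ hQle
    exact hmax i
  · intro Q Q' hQ hQ' hQle hQ'le heq
    obtain ⟨i, rfl⟩ := hle Q hQ hQle
    obtain ⟨j, rfl⟩ := hle Q' hQ' hQ'le
    by_contra hne
    obtain ⟨r, hr, hr'⟩ := hlift i 1 (k i).one_mem
    have h1 : r ∈ (N j).comap (algebraMap R T) := hr' j fun h => hne (h ▸ rfl)
    rw [← heq, Ideal.mem_comap, ← Ideal.Quotient.eq_zero_iff_mem, hr] at h1
    have := (hN i).isPrime.ne_top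
    rw [Ideal.ne_top_iff_one, ← Ideal.Quotient.eq_zero_iff_mem, map_one] at this
    exact this h1

theorem exists_pullbackSubring [IsDomain R] (h : IsPseudoDedekind R T) (hR : ¬ IsField R) :
    ∃ (n : ℕ) (_ : 0 < n) (N : Fin n → Ideal T) (k : ∀ i, Subring (T ⧸ N i)),
      (∀ i, (N i).IsMaximal) ∧ Function.Injective N ∧ (∀ i, IsField (k i)) ∧
        (algebraMap R T).range = pullbackSubring N k := by
  obtain ⟨N₀, hN₀⟩ := Ideal.exists_maximal T
  have hN₀0 : N₀ ≠ ⊥ := Ring.ne_bot_of_isMaximal_of_not_isField hN₀ (h.not_isField hR)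
  -- The extra `N₀` keeps the list of primes nonempty even when `R = T` and the conductor is the
  -- unit ideal.
  have hI0 : algebraConductor R T * N₀ ≠ ⊥ := mul_ne_zero h.algebraConductor_ne_bot hN₀0
  set S := {Q : Ideal T | Q.IsPrime ∧ algebraConductor R T * N₀ ≤ Q} with hS
  have hfin : Finite S := finite_setOf_isPrime_le hI0
  obtain ⟨n, ⟨e⟩⟩ := Finite.exists_equiv_fin S
  let N : Fin n → Ideal T := fun i => e.symm i
  have hNprime : ∀ i, (N i).IsPrime := fun i => (e.symm i).2.1
  have hN0 : ∀ i, N i ≠ ⊥ := fun i => ne_bot_of_le_ne_bot hI0 (e.symm i).2.2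
  have hN : ∀ i, (N i).IsMaximal := fun i => (hNprime i).isMaximal (hN0 i)
  have hNinj : Function.Injective N := Subtype.val_injective.comp e.symm.injective
  have hcmax : ∀ i, ((N i).comap (algebraMap R T)).IsMaximal := fun i =>
    h.isMaximal_comap _ (hNprime i) (hN0 i)
  refine ⟨n, (e ⟨N₀, hN₀.isPrime, Ideal.mul_le_right⟩).pos, N,
    fun i => ((Ideal.Quotient.mk (N i)).comp (algebraMap R T)).range, hN, hNinj, fun i => ?_, ?_⟩
  · have hker : RingHom.ker ((Ideal.Quotient.mk (N i)).comp (algebraMap R T)) =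
        (N i).comap (algebraMap R T) := by
      rw [← RingHom.comap_ker, Ideal.mk_ker]
    have hf : IsField (R ⧸ RingHom.ker ((Ideal.Quotient.mk (N i)).comp (algebraMap R T))) := by
      rw [← Ideal.Quotient.maximal_ideal_iff_isField_quotient, hker]
      exact hcmax i
    exact (RingHom.quotientKerEquivRange _).symm.toMulEquiv.isField hf
  · ext t
    rw [mem_pullbackSubring]
    constructor
    · rintro ⟨r, rfl⟩ i
      exact ⟨r, rfl⟩
    · intro ht
      choose r hr using ht
      have hcop : Pairwise (Function.onFun IsCoprime
          fun i => (N i).comap (algebraMap R T)) := fun i j hij => by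
        have := hcmax i
        have := hcmax j
        exact Ideal.isCoprime_of_isMaximal fun heq =>
          hij (hNinj (h.eq_of_comap_eq (hNprime i) (hNprime j) (hN0 i) (hN0 j) heq))
      -- Distinct contractions permit the Chinese remainder theorem in `R`. The resulting `t - a`
      -- lies in every prime over the conductor, hence in the conductor, which is inside `R`.
      obtain ⟨a, ha⟩ := Ideal.exists_forall_sub_mem_ideal hcop r
      have hsub : t - algebraMap R T a ∈ algebraConductor R T := by
        refine h.mem_algebraConductor_of_forall hR fun Q hQ hCQ => ?_
        have hQS : Q ∈ S := ⟨hQ, Ideal.mul_le_left.trans hCQ⟩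
        have hQN : N (e ⟨Q, hQS⟩) = Q := by simp [N]
        rw [← hQN]
        have h1 := ha (e ⟨Q, hQS⟩)
        rw [Ideal.mem_comap, map_sub] at h1
        have h2 := Ideal.Quotient.eq.1 (hr (e ⟨Q, hQS⟩))
        have := Ideal.neg_mem_iff _ |>.2 (Ideal.add_mem _ h1 h2)
        convert this using 1
        ring
      obtain ⟨b, hb⟩ := exists_algebraMap_eq_of_mem_algebraConductor hsub
      exact ⟨b + a, by rw [map_add, hb, sub_add_cancel]⟩

end IsPseudoDedekind

/-! ### Conductors of subalgebras of the quotient field -/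

section Subalgebra

variable {R K : Type*} [CommRing R] [Field K] [Algebra R K]

theorem conductorAbove_eq_algebraConductor (T : Subalgebra R K) :
    conductorAbove T = algebraConductor R T := by
  ext t
  change (t : K) ∈ overringConductor T ↔ _
  rw [mem_overringConductor, mem_algebraConductor]
  constructor
  · intro h u
    obtain ⟨r, hr⟩ := h u u.2
    exact ⟨r, Subtype.ext hr⟩
  · intro h u hu
    obtain ⟨r, hr⟩ := h ⟨u, hu⟩
    exact ⟨r, congrArg Subtype.val hr⟩

theorem conductorBelow_eq_comap (T : Subalgebra R K) :
    conductorBelow T = (algebraConductor R T).comap (algebraMap R T) := by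
  rw [← conductorAbove_eq_algebraConductor]; rfl

theorem exists_algebraMap_eq_of_mem_conductorAbove {T : Subalgebra R K} {t : T}
    (ht : t ∈ conductorAbove T) : ∃ r, algebraMap R T r = t :=
  exists_algebraMap_eq_of_mem_algebraConductor (conductorAbove_eq_algebraConductor T ▸ ht)

theorem IsUnibranched.quotientMap_congr {A B : Type*} [CommRing A] [CommRing B] {f : A →+* B}
    {I I' : Ideal B} {J J' : Ideal A} (hI : I = I') (hJ : J = J') (hle : J ≤ I.comap f)
    (hle' : J' ≤ I'.comap f) (h : IsUnibranched (Ideal.quotientMap I f hle)) :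
    IsUnibranched (Ideal.quotientMap I' f hle') := by
  subst hI hJ; exact h

variable {T : Subalgebra R K}

theorem IsPseudoDedekind.isUnibranched_conductorQuotientMap [IsDomain R] [IsDedekindDomain T]
    (h : IsPseudoDedekind R T) (hR : ¬ IsField R) : IsUnibranched (conductorQuotientMap T) :=
  (h.isUnibranched_quotientMap hR).quotientMap_congr (conductorAbove_eq_algebraConductor T).symm
    (conductorBelow_eq_comap T).symm _ _

theorem Subalgebra.algebraMap_injective_of_isFractionRing [IsFractionRing R K]
    (T : Subalgebra R K) : Function.Injective (algebraMap R T) := fun _ _ h =>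
  IsFractionRing.injective R K (congrArg Subtype.val h)

theorem IsPseudoDedekind.of_conductorQuotientMap [IsDomain R] [IsFractionRing R K]
    [IsDedekindDomain T] (hR : ¬ IsField R)
    (hart : IsArtinianRing (R ⧸ conductorBelow T)) (hred : IsReduced (T ⧸ conductorAbove T))
    (hub : IsUnibranched (conductorQuotientMap T)) : IsPseudoDedekind R T := by
  have hinj := T.algebraMap_injective_of_isFractionRing
  have hcomm : ∀ Q : Ideal (T ⧸ conductorAbove T),
      (Q.comap (conductorQuotientMap T)).comap (Ideal.Quotient.mk (conductorBelow T)) =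
      (Q.comap (Ideal.Quotient.mk (conductorAbove T))).comap (algebraMap R T) := fun Q => by
    rw [Ideal.comap_comap, Ideal.comap_comap]; rfl
  have hcm : ∀ Q : Ideal T, conductorAbove T ≤ Q →
      (Q.map (Ideal.Quotient.mk (conductorAbove T))).comap (Ideal.Quotient.mk _) = Q := by
    intro Q hCQ
    rw [Ideal.comap_map_of_surjective _ Ideal.Quotient.mk_surjective, ← RingHom.ker_eq_comap_bot,
      Ideal.mk_ker, sup_eq_left.2 hCQ]
  have hmapprime : ∀ Q : Ideal T, Q.IsPrime → conductorAbove T ≤ Q →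
      (Q.map (Ideal.Quotient.mk (conductorAbove T))).IsPrime := fun Q hQ hCQ =>
    Ideal.map_isPrime_of_surjective Ideal.Quotient.mk_surjective (by rwa [Ideal.mk_ker])
  refine of_isRadical hinj (B := conductorAbove T) ?_ ?_ ?_ ?_ ?_
  -- With zero conductor `R` would be an Artinian domain, hence a field.
  · intro hbot
    have : conductorBelow T = ⊥ := by
      change (conductorAbove T).comap (algebraMap R T) = ⊥
      rw [hbot]
      exact Ideal.comap_bot_of_injective _ hinj
    rw [this] at hart
    have : IsArtinianRing R := (RingEquiv.quotientBot R).surjective.isArtinianRing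
    exact hR (IsArtinianRing.isField_of_isDomain R)
  · rwa [Ideal.isRadical_iff_quotient_reduced]
  · exact fun b hb => exists_algebraMap_eq_of_mem_conductorAbove hb
  · intro Q hQ hCQ
    have h1 := hmapprime Q hQ hCQ
    have h2 : ((Q.map (Ideal.Quotient.mk (conductorAbove T))).comap
      (conductorQuotientMap T)).IsMaximal :=
        IsArtinianRing.isMaximal_of_isPrime _
    have h3 := Ideal.comap_isMaximal_of_surjective (Ideal.Quotient.mk (conductorBelow T))
      Ideal.Quotient.mk_surjective (K := (Q.map (Ideal.Quotient.mk (conductorAbove T))).comap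
      (conductorQuotientMap T))
    rwa [hcomm, hcm Q hCQ] at h3
  · intro Q Q' hQ hQ' hCQ hCQ' heq
    have h1 := hmapprime Q hQ hCQ
    have h2 := hmapprime Q' hQ' hCQ'
    have h3 := (hub.2 _ (Ideal.IsPrime.comap (K := Q.map (Ideal.Quotient.mk (conductorAbove T)))
      (conductorQuotientMap T))).unique ⟨h1, rfl⟩ ⟨h2, by
        refine Ideal.comap_injective_of_surjective _ Ideal.Quotient.mk_surjective ?_
        rw [hcomm, hcomm, hcm Q hCQ, hcm Q' hCQ', heq]⟩
    rw [← hcm Q hCQ, h3, hcm Q' hCQ']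

/-! ### Globalized pseudo-valuation domains -/

theorem IsDedekindDomain.isPruferDomain {T : Type*} [CommRing T] [IsDedekindDomain T]
    (hT : ¬ IsField T) : IsPruferDomain T := fun M _ => by
  have := IsLocalization.AtPrime.isDiscreteValuationRing_of_dedekind_domain T
    (Ring.ne_bot_of_isMaximal_of_not_isField ‹_› hT) (Localization.AtPrime M)
  infer_instance

theorem IsPseudoDedekind.isGPVD [IsDomain R] [IsDedekindDomain T] (h : IsPseudoDedekind R T)
    (hR : ¬ IsField R) : IsGPVD R K := by
  refine ⟨T, IsDedekindDomain.isPruferDomain (h.not_isField hR), h.isUnibranched hR,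
    (algebraConductor R T).comap (algebraMap R T), algebraConductor R T, ?_,
    h.comap_algebraConductor_ne_bot, (h.isRadical_algebraConductor hR).comap _,
    h.isRadical_algebraConductor hR, fun P hP hle => ?_, fun Q hQ hle => ?_⟩
  · ext t
    constructor
    · rintro ⟨r, hr, rfl⟩
      exact hr
    · intro ht
      obtain ⟨r, rfl⟩ := exists_algebraMap_eq_of_mem_algebraConductor ht
      exact ⟨r, ht, rfl⟩
  · exact h.isMaximal_of_isPrime hR hP (ne_bot_of_le_ne_bot h.comap_algebraConductor_ne_bot hle)
  · exact hQ.isMaximal (ne_bot_of_le_ne_bot h.algebraConductor_ne_bot hle)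

end Subalgebra

/-! ### Pseudo-Dedekind domains are Mori -/

section Mori

variable {R K : Type*} [CommRing R] [Field K] [Algebra R K]

theorem mem_one_div_coeSubmodule {I : Ideal R} {x : K} :
    x ∈ (1 : Submodule R K) / IsLocalization.coeSubmodule K I ↔
      ∀ i ∈ I, ∃ r, algebraMap R K r = x * algebraMap R K i := by
  rw [Submodule.mem_div_iff_forall_mul_mem]
  constructor
  · intro h i hi
    exact Submodule.mem_one.1 (h _ ⟨i, hi, rfl⟩)
  · rintro h _ ⟨i, hi, rfl⟩
    exact Submodule.mem_one.2 (h i hi)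

/-- One element of `I` generates `IT` locally at all primes over `C`. For each such `Q` some element
of `I` avoids `Q · IT`, and the Chinese remainder theorem in `R` glues these elements. -/
theorem IsPseudoDedekind.exists_mem_map_le_span_sup {T : Type*} [CommRing T] [IsDedekindDomain T]
    [Algebra R T] (h : IsPseudoDedekind R T) {I : Ideal R} (hI : I ≠ ⊥) :
    ∃ a ∈ I, I.map (algebraMap R T) ≤
      Ideal.span {algebraMap R T a} ⊔ algebraConductor R T * I.map (algebraMap R T) := by
  classical
  set J := I.map (algebraMap R T)
  set C := algebraConductor R T
  have hJ0 : J ≠ ⊥ := by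
    rwa [Ne, Ideal.map_eq_bot_iff_of_injective h.injective]
  set S := {Q : Ideal T | Q.IsPrime ∧ C ≤ Q}
  have hS : S.Finite := IsPseudoDedekind.finite_setOf_isPrime_le h.algebraConductor_ne_bot
  have : Fintype S := hS.fintype
  have hne : ∀ Q : S, (Q : Ideal T) ≠ ⊥ := fun Q =>
    ne_bot_of_le_ne_bot h.algebraConductor_ne_bot Q.2.2
  have hmax : ∀ Q : S, ((Q : Ideal T).comap (algebraMap R T)).IsMaximal := fun Q =>
    h.isMaximal_comap _ Q.2.1 (hne Q)
  have hex : ∀ Q : S, ∃ a ∈ I, algebraMap R T a ∉ (Q : Ideal T) * J := by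
    intro Q
    by_contra! hcon
    have h1 : J ≤ Q * J := Ideal.map_le_iff_le_comap.2 hcon
    have h2 : J * Q = J * ⊤ := by
      rw [Ideal.mul_top]
      exact le_antisymm Ideal.mul_le_left (by rwa [mul_comm])
    exact Q.2.1.ne_top (mul_left_cancel₀ hJ0 h2)
  choose b hbI hb using hex
  have hcop : Pairwise (Function.onFun IsCoprime
      fun Q : S => (Q : Ideal T).comap (algebraMap R T)) := fun Q Q' hQQ' => by
    have := hmax Q
    have := hmax Q'
    exact Ideal.isCoprime_of_isMaximal fun heq =>
      hQQ' (Subtype.ext (h.eq_of_comap_eq Q.2.1 Q'.2.1 (hne Q) (hne Q') heq))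
  have hex : ∀ Q : S, ∃ e : R, algebraMap R T e - 1 ∈ (Q : Ideal T) ∧
      ∀ Q' : S, Q' ≠ Q → algebraMap R T e ∈ (Q' : Ideal T) := by
    intro Q
    obtain ⟨e, he⟩ := Ideal.exists_forall_sub_mem_ideal hcop fun Q' => if Q' = Q then 1 else 0
    refine ⟨e, by simpa using he Q, fun Q' hQ' => by simpa [hQ'] using he Q'⟩
  choose e he he' using hex
  set a := ∑ Q : S, e Q * b Q
  have haI : a ∈ I := I.sum_mem fun Q _ => I.mul_mem_left _ (hbI Q)
  have hbJ : ∀ Q, algebraMap R T (b Q) ∈ J := fun Q => Ideal.mem_map_of_mem _ (hbI Q)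
  have ha : ∀ Q : S, algebraMap R T a ∉ (Q : Ideal T) * J := by
    intro Q haQ
    refine hb Q ?_
    have hsum : algebraMap R T a = algebraMap R T (e Q) * algebraMap R T (b Q) +
        ∑ Q' ∈ Finset.univ.erase Q, algebraMap R T (e Q') * algebraMap R T (b Q') := by
      rw [Finset.add_sum_erase _ (fun Q' => algebraMap R T (e Q') * algebraMap R T (b Q'))
        (Finset.mem_univ Q)]
      simp [a]
    have hrest : ∑ Q' ∈ Finset.univ.erase Q, algebraMap R T (e Q') * algebraMap R T (b Q') ∈
        (Q : Ideal T) * J := Ideal.sum_mem _ fun Q' hQ' =>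
      Ideal.mul_mem_mul (he' Q' Q (Finset.ne_of_mem_erase hQ').symm) (hbJ Q')
    rw [hsum] at haQ
    have h1 := (Ideal.add_mem_iff_left _ hrest).1 haQ
    have h2 := Ideal.sub_mem _ h1 (Ideal.mul_mem_mul (he Q) (hbJ Q))
    convert h2 using 1
    ring
  refine ⟨a, haI, ?_⟩
  have hLJ : Ideal.span {algebraMap R T a} ⊔ C * J ≤ J :=
    sup_le (by rw [Ideal.span_singleton_le_iff_mem]; exact Ideal.mem_map_of_mem _ haI)
      Ideal.mul_le_right
  obtain ⟨L, hL⟩ := Ideal.dvd_iff_le.2 hLJ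
  rw [hL]
  have hCL : C ≤ L := by
    have h1 : C * J ≤ J * L := hL ▸ le_sup_right
    rw [mul_comm C, ← Ideal.dvd_iff_le] at h1
    exact Ideal.dvd_iff_le.1 ((mul_dvd_mul_iff_left hJ0).1 h1)
  suffices L = ⊤ by rw [this, Ideal.mul_top]
  by_contra hLt
  obtain ⟨Q, hQ, hLQ⟩ := Ideal.exists_le_maximal L hLt
  refine ha ⟨Q, hQ.isPrime, hCL.trans hLQ⟩ ?_
  have h1 : algebraMap R T a ∈ J * L :=
    hL ▸ Ideal.mem_sup_left (Ideal.mem_span_singleton_self _)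
  rw [mul_comm]
  exact Ideal.mul_mono_right hLQ h1

variable [IsDomain R] [IsFractionRing R K] {T : Subalgebra R K} [IsDedekindDomain T]

/-- Divisorial ideals are determined by their duals `D m`. Once the extensions to `T` are constant,
`hkey` shows that an element of `D m` matters only through its product with `a` modulo the
conductor, so the Artinian quotient of `R` stops the descending chain of duals. -/
theorem IsPseudoDedekind.isMoriDomain (h : IsPseudoDedekind R T) (hR : ¬ IsField R) :
    IsMoriDomain R K := by
  intro f hf hdiv
  have hinjK := IsFractionRing.injective R K
  set C := algebraConductor R T with hC
  set Cb := C.comap (algebraMap R T) with hCb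
  have hartin : IsArtinianRing (R ⧸ Cb) := h.isArtinianRing_quotient_comap hR
  have hcoe : ∀ r : R, ((algebraMap R T r : T) : K) = algebraMap R K r := fun _ => rfl
  have hCR : ∀ t : T, t ∈ C → ∃ r, algebraMap R K r = (t : K) := fun t ht => by
    obtain ⟨r, rfl⟩ := exists_algebraMap_eq_of_mem_algebraConductor ht
    exact ⟨r, rfl⟩
  obtain ⟨n₀, hn₀⟩ := monotone_stabilizes_iff_noetherian.2 (inferInstance : IsNoetherian T T)
    ⟨fun n => (f n).map (algebraMap R T), fun _ _ hmn => Ideal.map_mono (hf hmn)⟩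
  replace hn₀ : ∀ m, n₀ ≤ m → (f n₀).map (algebraMap R T) = (f m).map (algebraMap R T) := hn₀
  obtain ⟨a, haI, ha⟩ := h.exists_mem_map_le_span_sup (hdiv n₀).1
  set D : ℕ → Submodule R K := fun m => 1 / IsLocalization.coeSubmodule K (f m) with hD
  have hDmem : ∀ {m x}, x ∈ D m ↔ ∀ i ∈ f m, ∃ r, algebraMap R K r = x * algebraMap R K i :=
    mem_one_div_coeSubmodule
  have hDanti : ∀ {m n}, m ≤ n → D n ≤ D m := fun hmn x hx =>
    hDmem.2 fun i hi => hDmem.1 hx i (hf hmn hi)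
  -- an element of the first dual that `a` maps into the conductor lies in all duals
  have hkey : ∀ x ∈ D n₀, (∃ c ∈ C, (c : K) = x * algebraMap R K a) → ∀ m, n₀ ≤ m → x ∈ D m := by
    rintro x hx ⟨c, hc, hcx⟩ m hm
    have hxJ : ∀ j ∈ (f n₀).map (algebraMap R T), ∃ t : T, (t : K) = x * j := by
      intro j hj
      refine Submodule.span_induction (p := fun (j : T) _ => ∃ t : T, (t : K) = x * j)
        ?_ ?_ ?_ ?_ hj
      · rintro _ ⟨i, hi, rfl⟩
        obtain ⟨r, hr⟩ := hDmem.1 hx i hi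
        exact ⟨algebraMap R T r, hr⟩
      · exact ⟨0, by simp⟩
      · rintro y z - - ⟨t, ht⟩ ⟨u, hu⟩
        exact ⟨t + u, by push_cast; rw [ht, hu]; ring⟩
      · rintro s y - ⟨t, ht⟩
        exact ⟨s * t, by push_cast; rw [smul_eq_mul]; push_cast; rw [ht]; ring⟩
    have hxCJ : ∀ w ∈ C * (f n₀).map (algebraMap R T), ∃ t ∈ C, (t : K) = x * w := by
      intro w hw
      refine Submodule.mul_induction_on hw (fun c' hc' j hj => ?_) ?_
      · obtain ⟨t, ht⟩ := hxJ j hj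
        exact ⟨c' * t, C.mul_mem_right _ hc', by push_cast; rw [ht]; ring⟩
      · rintro y z ⟨t, ht, hty⟩ ⟨u, hu, huz⟩
        exact ⟨t + u, C.add_mem ht hu, by push_cast; rw [hty, huz]; ring⟩
    refine hDmem.2 fun i hi => ?_
    have hiJ : algebraMap R T i ∈ (f n₀).map (algebraMap R T) := by
      rw [hn₀ m hm]; exact Ideal.mem_map_of_mem _ hi
    obtain ⟨t, w, hw, htw⟩ := Ideal.mem_span_singleton_sup.1 (ha hiJ)
    obtain ⟨u, hu, hux⟩ := hxCJ w hw
    obtain ⟨r, hr⟩ := hCR (t * c + u) (C.add_mem (C.mul_mem_left _ hc) hu)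
    refine ⟨r, ?_⟩
    rw [hr, ← hcoe i, ← htw]
    push_cast
    rw [hcx, hux]
    ring
  let E : ℕ → Ideal R := fun m =>
    { carrier := {r | ∃ x ∈ D m, algebraMap R K r = x * algebraMap R K a}
      add_mem' := by
        rintro r s ⟨x, hx, hrx⟩ ⟨y, hy, hsy⟩
        exact ⟨x + y, (D m).add_mem hx hy, by rw [map_add, hrx, hsy, add_mul]⟩
      zero_mem' := ⟨0, (D m).zero_mem, by simp⟩
      smul_mem' := by
        rintro r s ⟨x, hx, hsx⟩
        exact ⟨r • x, (D m).smul_mem r hx, by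
          rw [smul_eq_mul, map_mul, hsx, Algebra.smul_def, mul_assoc]⟩ }
  have hE : ∀ {m r}, r ∈ E m ↔ ∃ x ∈ D m, algebraMap R K r = x * algebraMap R K a := Iff.rfl
  have hEanti : Antitone E := fun m n hmn r hr => by
    obtain ⟨x, hx, hrx⟩ := hE.1 hr
    exact hE.2 ⟨x, hDanti hmn hx, hrx⟩
  obtain ⟨n₁, hn₁⟩ := IsArtinian.monotone_stabilizes (R := R ⧸ Cb) (M := R ⧸ Cb)
    ⟨fun m => OrderDual.toDual ((E m).map (Ideal.Quotient.mk Cb)),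
      fun m n hmn => Ideal.map_mono (hEanti hmn)⟩
  replace hn₁ : ∀ m, n₁ ≤ m → (E n₁).map (Ideal.Quotient.mk Cb) =
    (E m).map (Ideal.Quotient.mk Cb) := hn₁
  set N := max n₀ n₁
  have hstab : ∀ m, N ≤ m → D N ≤ D m := by
    intro m hm x hx
    obtain ⟨r, hr⟩ := hDmem.1 hx a (hf (le_max_left n₀ n₁) haI)
    have hrE : Ideal.Quotient.mk Cb r ∈ (E m).map (Ideal.Quotient.mk Cb) := by
      rw [← hn₁ m (le_trans (le_max_right _ _) hm), hn₁ N (le_max_right _ _)]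
      exact Ideal.mem_map_of_mem _ (hE.2 ⟨x, hx, hr⟩)
    obtain ⟨s, hs, hsr⟩ := (Ideal.mem_map_iff_of_surjective _ Ideal.Quotient.mk_surjective).1 hrE
    obtain ⟨y, hy, hsy⟩ := hE.1 hs
    have hrs : r - s ∈ Cb := Ideal.Quotient.eq.1 hsr.symm
    have hm₀ : n₀ ≤ m := le_trans (le_max_left _ _) hm
    have hxy := hkey (x - y) (Submodule.sub_mem _ (hDanti (le_max_left _ _) hx) (hDanti hm₀ hy))
      ⟨algebraMap R T (r - s), hrs, by rw [hcoe, map_sub, hr, hsy]; ring⟩ m hm₀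
    have := (D m).add_mem hxy hy
    rwa [sub_add_cancel] at this
  refine ⟨N, fun m hm => ?_⟩
  have hDD : D m = D N := le_antisymm (hDanti hm) (hstab m hm)
  apply IsLocalization.coeSubmodule_injective (S := K) (le_refl (nonZeroDivisors R))
  rw [← (hdiv m).2, ← (hdiv N).2]
  change 1 / D m = 1 / D N
  rw [hDD]

end Mori

/-! ### Mori GPVDs -/

theorem IsPruferDomain.exists_dvd_or_dvd {T : Type*} [CommRing T] [IsDomain T]
    (hT : IsPruferDomain T) {Q : Ideal T} (hQ : Q.IsMaximal) (a b : T) :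
    (∃ s, s ∉ Q ∧ a ∣ s * b) ∨ ∃ s, s ∉ Q ∧ b ∣ s * a := by
  have hval := hT Q
  have key : ∀ a b : T, algebraMap T (Localization.AtPrime Q) a ∣ algebraMap T _ b →
      ∃ s, s ∉ Q ∧ a ∣ s * b := by
    rintro a b ⟨z, hz⟩
    obtain ⟨⟨w, s⟩, hw⟩ := IsLocalization.surj Q.primeCompl z
    refine ⟨s, s.2, w, IsLocalization.injective (Localization.AtPrime Q)
      Q.primeCompl_le_nonZeroDivisors ?_⟩
    simp only at hw
    rw [map_mul, map_mul, hz, ← hw]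
    ring
  exact (ValuationRing.dvd_total (algebraMap T (Localization.AtPrime Q) a)
    (algebraMap T _ b)).imp (key a b) (key b a)

/-- Finitely generated ideals are locally principal: of two local generators one divides the other
up to a factor outside `Q`. -/
theorem IsPruferDomain.exists_dvd_of_fg {T : Type*} [CommRing T] [IsDomain T]
    (hT : IsPruferDomain T) {I : Ideal T} (hI : I.FG) {Q : Ideal T} (hQ : Q.IsMaximal) :
    ∃ a ∈ I, ∃ s, s ∉ Q ∧ ∀ b ∈ I, a ∣ s * b := by
  have hmul : ∀ {x y : T}, x ∉ Q → y ∉ Q → x * y ∉ Q :=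
    fun hx hy hxy => (hQ.isPrime.mem_or_mem hxy).elim hx hy
  induction I, hI using Submodule.fg_induction with
  | singleton x =>
    refine ⟨x, Submodule.mem_span_singleton_self x, 1,
      fun h => hQ.ne_top ((Ideal.eq_top_iff_one _).2 h), fun b hb => ?_⟩
    rw [one_mul]
    exact Ideal.mem_span_singleton.1 hb
  | sup I₁ I₂ _ _ ih₁ ih₂ =>
    obtain ⟨a₁, ha₁, s₁, hs₁, h₁⟩ := ih₁
    obtain ⟨a₂, ha₂, s₂, hs₂, h₂⟩ := ih₂
    have key : ∀ {I₁ I₂ : Ideal T} {a₁ a₂ s₁ s₂ s : T}, (∀ b ∈ I₁, a₁ ∣ s₁ * b) →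
        (∀ b ∈ I₂, a₂ ∣ s₂ * b) → a₁ ∣ s * a₂ → ∀ b ∈ I₁ ⊔ I₂, a₁ ∣ s * s₁ * s₂ * b := by
      intro I₁ I₂ a₁ a₂ s₁ s₂ s h₁ h₂ hs b hb
      obtain ⟨b₁, hb₁, b₂, hb₂, rfl⟩ := Submodule.mem_sup.1 hb
      have e : s * s₁ * s₂ * (b₁ + b₂) = s * s₂ * (s₁ * b₁) + s₁ * (s * (s₂ * b₂)) := by ring
      rw [e]
      exact dvd_add ((h₁ b₁ hb₁).mul_left _)
        ((hs.trans (mul_dvd_mul_left s (h₂ b₂ hb₂))).mul_left _)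
    rcases hT.exists_dvd_or_dvd hQ a₁ a₂ with ⟨s, hs, h⟩ | ⟨s, hs, h⟩
    · exact ⟨a₁, Ideal.mem_sup_left ha₁, _, hmul (hmul hs hs₁) hs₂, key h₁ h₂ h⟩
    · refine ⟨a₂, Ideal.mem_sup_right ha₂, _, hmul (hmul hs hs₂) hs₁, ?_⟩
      rw [sup_comm]
      exact key h₂ h₁ h

theorem IsPruferDomain.exists_dvd_of_fg_of_ne_bot {T : Type*} [CommRing T] [IsDomain T]
    (hT : IsPruferDomain T) {I : Ideal T} (hI : I.FG) (hI0 : I ≠ ⊥) {Q : Ideal T}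
    (hQ : Q.IsMaximal) : ∃ a ∈ I, a ≠ 0 ∧ ∃ s, s ∉ Q ∧ ∀ b ∈ I, a ∣ s * b := by
  obtain ⟨a, ha, s, hs, h⟩ := hT.exists_dvd_of_fg hI hQ
  refine ⟨a, ha, ?_, s, hs, h⟩
  rintro rfl
  obtain ⟨b, hb, hb0⟩ := Submodule.exists_mem_ne_zero_of_ne_bot hI0
  rcases mul_eq_zero.1 (zero_dvd_iff.1 (h b hb)) with h | h
  · exact hs (h ▸ Q.zero_mem)
  · exact hb0 h

/-! ### Prüfer overrings of Mori domains -/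

section GPVD

variable {R K : Type*} [CommRing R] [Field K] [Algebra R K] [IsFractionRing R K]
  {T : Subalgebra R K}

/-- A conductor of a Prüfer overring that contains a radical ideal all of whose primes are
maximal has no multipliers outside the overring. -/
theorem IsPruferDomain.mem_of_mul_algebraConductor_subset (hT : IsPruferDomain T) {B : Ideal T}
    (hB : B ≤ algebraConductor R T) (hBrad : B.IsRadical)
    (hBmax : ∀ Q : Ideal T, Q.IsPrime → B ≤ Q → Q.IsMaximal) {x : K}
    (hx : ∀ c ∈ algebraConductor R T, ∃ c' ∈ algebraConductor R T, (c' : K) = x * c) : x ∈ T := by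
  let A : Ideal T :=
    { carrier := {t | ∃ u : T, (u : K) = x * t}
      add_mem' := by
        rintro s t ⟨u, hu⟩ ⟨w, hw⟩
        exact ⟨u + w, by push_cast; rw [hu, hw, mul_add]⟩
      zero_mem' := ⟨0, by simp⟩
      smul_mem' := by
        rintro s t ⟨u, hu⟩
        exact ⟨s * u, by rw [smul_eq_mul]; push_cast; rw [hu]; ring⟩ }
  suffices A = ⊤ by
    obtain ⟨u, hu⟩ : (1 : T) ∈ A := this ▸ trivial
    rw [OneMemClass.coe_one, mul_one] at hu
    exact hu ▸ u.2
  by_contra hA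
  obtain ⟨Q, hQ, hAQ⟩ := Ideal.exists_le_maximal A hA
  have hCA : algebraConductor R T ≤ A := fun c hc => by
    obtain ⟨c', -, hc'⟩ := hx c hc
    exact ⟨c', hc'⟩
  have hCQ := hCA.trans hAQ
  obtain ⟨a, b, hb, rfl⟩ := IsFractionRing.div_surjective T x
  have hb0 : (b : K) ≠ 0 := fun h => nonZeroDivisors.ne_zero hb (Subtype.ext h)
  change ∀ c ∈ algebraConductor R T, ∃ c' ∈ algebraConductor R T, (c' : K) = a / b * c at hx
  rcases hT.exists_dvd_or_dvd hQ a b with ⟨s, hs, d, hd⟩ | ⟨s, hs, u, hu⟩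
  · have hxd : (a : K) / b * d = s := by
      rw [div_mul_eq_mul_div, div_eq_iff hb0]
      exact_mod_cast hd.symm
    have hdQ : d ∈ Q := hAQ ⟨s, hxd.symm⟩
    have hBQ := hB.trans hCQ
    -- Minimality and radicality give `s'd ∈ B` with `s' ∉ Q`. Then `x · s'd = s's` lies in the
    -- conductor, hence in `Q`, although `s', s ∉ Q`.
    have hQmin : Q ∈ B.minimalPrimes :=
      ⟨⟨hQ.isPrime, hBQ⟩, fun P hP hPQ =>
        ((hBmax P hP.1 hP.2).eq_of_le hQ.ne_top hPQ).ge⟩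
    obtain ⟨s', hs', n, hn⟩ := Ideal.exists_mul_pow_mem_of_mem_minimalPrimes hQmin hdQ
    have hsd : s' * d ∈ B := hBrad ⟨n + 1, by
      have e : (s' * d) ^ (n + 1) = s' ^ n * d * (s' * d ^ n) := by ring
      exact e ▸ B.mul_mem_left _ hn⟩
    obtain ⟨c', hc', hc⟩ := hx _ (hB hsd)
    have hss : c' = s' * s := Subtype.ext <| by
      rw [hc]
      push_cast
      rw [← hxd]
      ring
    exact (hQ.isPrime.mem_or_mem (hss ▸ hCQ hc')).elim hs' hs
  · refine hs (hAQ ⟨u, ?_⟩)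
    change (u : K) = a / b * s
    rw [div_mul_eq_mul_div, eq_div_iff hb0, mul_comm (a : K), mul_comm (u : K)]
    exact_mod_cast hu.symm

open scoped nonZeroDivisors in
theorem Ideal.exists_coe_eq_of_mul_inv {I L : Ideal T}
    (hI : (I : FractionalIdeal T⁰ K) * (I : FractionalIdeal T⁰ K)⁻¹ = 1) {x : K}
    (h : ∀ a ∈ I, ∀ y ∈ (I : FractionalIdeal T⁰ K)⁻¹, ∃ w ∈ L, (w : K) = x * (a * y)) :
    ∃ w ∈ L, (w : K) = x := by
  have h1 : (1 : K) ∈ (I : FractionalIdeal T⁰ K) * (I : FractionalIdeal T⁰ K)⁻¹ :=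
    hI ▸ FractionalIdeal.one_mem_one T⁰
  suffices ∃ w ∈ L, (w : K) = x * 1 by rwa [mul_one] at this
  refine FractionalIdeal.mul_induction_on h1 (fun i hi y hy => ?_) fun y z hy hz => ?_
  · obtain ⟨a, ha, rfl⟩ := (FractionalIdeal.mem_coeIdeal _).1 hi
    exact h a ha y hy
  · obtain ⟨v, hv, hvx⟩ := hy
    obtain ⟨w, hw, hwx⟩ := hz
    exact ⟨v + w, L.add_mem hv hw, by push_cast; rw [hvx, hwx, mul_add]⟩

open scoped nonZeroDivisors in
theorem Ideal.exists_coe_eq_mul_of_mem_inv {I C : Ideal T} (hI : I ≠ ⊥) {y : K}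
    (hy : y ∈ (I : FractionalIdeal T⁰ K)⁻¹) {z : T} (hz : z ∈ C * I) :
    ∃ c ∈ C, (c : K) = y * z := by
  have hI0 : (I : FractionalIdeal T⁰ K) ≠ 0 := FractionalIdeal.coeIdeal_ne_zero.2 hI
  induction hz using Submodule.mul_induction_on' with
  | mem_mul_mem c hc i hi =>
    obtain ⟨u, hu⟩ := (FractionalIdeal.mem_one_iff _).1
      ((FractionalIdeal.mem_inv_iff hI0).1 hy i (FractionalIdeal.mem_coeIdeal_of_mem _ hi))
    change (u : K) = y * i at hu
    exact ⟨c * u, C.mul_mem_right _ hc, by push_cast; rw [hu]; ring⟩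
  | add a _ b _ iha ihb =>
    obtain ⟨v, hv, hvx⟩ := iha
    obtain ⟨w, hw, hwx⟩ := ihb
    exact ⟨v + w, C.add_mem hv hw, by push_cast; rw [hvx, hwx, mul_add]⟩

variable [IsDomain R]

open scoped nonZeroDivisors in
-- `J⁻¹` lies in the dual of `CJ`. So if `x` is in the bidual, `xJ⁻¹ ⊆ R`; as `J⁻¹` is a `T`-module,
-- even `xJ⁻¹ ⊆ C`, and invertibility yields `x ∈ CJ`.
theorem isDivisorialIdeal_comap_algebraConductor_mul (hC : algebraConductor R T ≠ ⊥)
    {J : Ideal T} (hJ : J ≠ ⊥)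
    (hinv : (J : FractionalIdeal T⁰ K) * (J : FractionalIdeal T⁰ K)⁻¹ = 1) :
    IsDivisorialIdeal R K ((algebraConductor R T * J).comap (algebraMap R T)) := by
  have hcoe : ∀ r : R, ((algebraMap R T r : T) : K) = algebraMap R K r := fun _ => rfl
  refine ⟨T.comap_ne_bot_of_ne_bot (mul_ne_zero hC hJ), le_antisymm ?_ ?_⟩
  · intro x hx
    rw [Submodule.mem_div_iff_forall_mul_mem] at hx
    have hxy : ∀ y ∈ (J : FractionalIdeal T⁰ K)⁻¹, ∃ c ∈ algebraConductor R T,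
        (c : K) = x * y := by
      intro y hy
      have hyt : ∀ t : T, ∃ r, algebraMap R K r = x * (y * t) := by
        intro t
        refine Submodule.mem_one.1 (hx _ (mem_one_div_coeSubmodule.2 fun d hd => ?_))
        obtain ⟨c, hc, hcy⟩ := Ideal.exists_coe_eq_mul_of_mem_inv hJ hy hd
        obtain ⟨r, hr⟩ := hc t
        refine ⟨r, ?_⟩
        rw [← hcoe, hr]
        push_cast
        rw [hcy, ← hcoe]
        ring
      obtain ⟨r, hr⟩ := hyt 1
      rw [OneMemClass.coe_one, mul_one] at hr
      refine ⟨algebraMap R T r, fun t => ?_, hr⟩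
      obtain ⟨r', hr'⟩ := hyt t
      refine ⟨r', Subtype.ext ?_⟩
      rw [hcoe, hr']
      push_cast
      rw [hr, mul_assoc]
    obtain ⟨w, hw, rfl⟩ := Ideal.exists_coe_eq_of_mul_inv (L := algebraConductor R T * J) hinv
      fun a ha y hy => by
        obtain ⟨c, hc, hcy⟩ := hxy y hy
        exact ⟨c * a, Ideal.mul_mem_mul hc ha, by
          rw [MulMemClass.coe_mul, hcy, mul_assoc, mul_comm y]⟩
    obtain ⟨r, rfl⟩ := exists_algebraMap_eq_of_mem_algebraConductor (Ideal.mul_le_left hw)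
    exact ⟨r, hw, rfl⟩
  · rintro _ ⟨d, hd, rfl⟩
    rw [Submodule.mem_div_iff_forall_mul_mem]
    intro y hy
    obtain ⟨r, hr⟩ := mem_one_div_coeSubmodule.1 hy d hd
    exact Submodule.mem_one.2 ⟨r, by rw [hr, mul_comm]; rfl⟩

open scoped nonZeroDivisors in
theorem IsMoriDomain.isNoetherianRing_of_isPruferDomain (hM : IsMoriDomain R K)
    (hT : IsPruferDomain T) {B : Ideal T} (hB0 : B ≠ ⊥) (hB : B ≤ algebraConductor R T)
    (hBrad : B.IsRadical) (hBmax : ∀ Q : Ideal T, Q.IsPrime → B ≤ Q → Q.IsMaximal) :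
    IsNoetherianRing T := by
  set C := algebraConductor R T
  have hC : C ≠ ⊥ := ne_bot_of_le_ne_bot hB0 hB
  have hinv : ∀ J : Ideal T, J.FG → J ≠ ⊥ →
      (J : FractionalIdeal T⁰ K) * (J : FractionalIdeal T⁰ K)⁻¹ = 1 := fun J hJ hJ0 =>
    Ideal.coeIdeal_mul_inv_of_forall_isMaximal K fun Q hQ => hT.exists_dvd_of_fg_of_ne_bot hJ hJ0 hQ
  -- If `CJ ⊆ CI`, then `jyC ⊆ C` for `j ∈ J` and `y ∈ I⁻¹`; since `C : C = T` this gives `jy ∈ T`,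
  -- and invertibility of `I` gives `j ∈ I`.
  have hcancel : ∀ I J : Ideal T, I.FG → I ≠ ⊥ →
      (C * J).comap (algebraMap R T) ≤ (C * I).comap (algebraMap R T) → J ≤ I := by
    intro I J hI hI0 hle j hj
    obtain ⟨w, hw, hwj⟩ := Ideal.exists_coe_eq_of_mul_inv (L := I) (x := j) (hinv I hI hI0)
      fun a ha y hy => by
        have hjy : (j : K) * y ∈ T := by
          refine hT.mem_of_mul_algebraConductor_subset hB hBrad hBmax fun c hc => ?_
          obtain ⟨r, hr⟩ := exists_algebraMap_eq_of_mem_algebraConductor hc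
          have hcj : c * j ∈ C * I := by
            have hcj := Ideal.mul_mem_mul hc hj
            obtain ⟨r, hr⟩ := exists_algebraMap_eq_of_mem_algebraConductor
              (Ideal.mul_le_left hcj)
            rw [← hr] at hcj ⊢
            exact hle hcj
          obtain ⟨c', hc', h⟩ := Ideal.exists_coe_eq_mul_of_mem_inv hI0 hy hcj
          exact ⟨c', hc', by rw [h, MulMemClass.coe_mul]; ring⟩
        exact ⟨⟨_, hjy⟩ * a, I.mul_mem_left _ ha, by
          rw [MulMemClass.coe_mul, mul_assoc, mul_comm y]⟩
    exact (Subtype.ext hwj : w = j) ▸ hw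
  rw [isNoetherianRing_iff, isNoetherian_iff_fg_wellFounded,
    wellFoundedGT_iff_monotone_chain_condition]
  intro J
  -- Divisorial ideals are nonzero, so the chain is shifted to start at a nonzero term.
  by_cases hJ : ∃ n, (J n : Ideal T) ≠ ⊥
  · obtain ⟨n, hn⟩ := hJ
    have hJ0 : ∀ m, (J (n + m) : Ideal T) ≠ ⊥ := fun m =>
      ne_bot_of_le_ne_bot hn (J.monotone (Nat.le_add_right n m))
    obtain ⟨m, hm⟩ := hM (fun m => (C * (J (n + m) : Ideal T)).comap (algebraMap R T))
      (fun a b hab => Ideal.comap_mono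
        (Ideal.mul_mono_right (J.monotone (Nat.add_le_add_left hab n))))
      fun m => isDivisorialIdeal_comap_algebraConductor_mul hC (hJ0 m)
        (hinv _ (J (n + m)).2 (hJ0 m))
    refine ⟨n + m, fun l hl => le_antisymm (J.monotone hl) ?_⟩
    obtain ⟨k, rfl⟩ := Nat.exists_eq_add_of_le ((Nat.le_add_right n m).trans hl)
    exact hcancel _ _ (J (n + m)).2 (hJ0 m) (hm k (by omega)).le
  · push Not at hJ
    exact ⟨0, fun m _ => Subtype.ext ((hJ 0).trans (hJ m).symm)⟩

theorem IsGPVD.isPseudoDedekind_completeIntegralClosure (hG : IsGPVD R K)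
    (hM : IsMoriDomain R K) :
    IsDedekindDomain (completeIntegralClosure R K) ∧
      IsPseudoDedekind R (completeIntegralClosure R K) := by
  obtain ⟨T, hT, hub, A, B, hAB, hA0, -, hBrad, hAmax, hBmax⟩ := hG
  have hBR : ∀ b ∈ B, ∃ r ∈ A, algebraMap R T r = b := fun b hb => by
    rwa [← SetLike.mem_coe, ← hAB] at hb
  have hAB' : ∀ a ∈ A, algebraMap R T a ∈ B := fun a ha => by
    rw [← SetLike.mem_coe, ← hAB]
    exact ⟨a, ha, rfl⟩
  have hB0 : B ≠ ⊥ := by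
    obtain ⟨a, ha, ha0⟩ := Submodule.exists_mem_ne_zero_of_ne_bot hA0
    exact Submodule.ne_bot_iff _ |>.2 ⟨_, hAB' a ha, (map_ne_zero_iff _ hub.1).2 ha0⟩
  have hBC : B ≤ algebraConductor R T := fun b hb t => by
    obtain ⟨r, -, hr⟩ := hBR _ (B.mul_mem_right t hb)
    exact ⟨r, hr⟩
  have hnoeth := hM.isNoetherianRing_of_isPruferDomain hT hB0 hBC hBrad hBmax
  have hDed : IsDedekindDomain T := isDedekindDomain_of_forall_ideal fun I hI Q hQ =>
    hT.exists_dvd_of_fg_of_ne_bot (IsNoetherian.noetherian I) hI hQ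
  refine (IsPseudoDedekind.of_isRadical hub.1 hB0 hBrad
    (fun b hb => (hBR b hb).imp fun _ h => h.2)
    (fun Q hQ hBQ => hAmax _ (hQ.comap _) fun a ha => hBQ (hAB' a ha))
    (fun Q Q' hQ hQ' _ _ h => ?_)).completeIntegralClosure K
  exact (hub.2 _ (hQ'.comap _)).unique ⟨hQ, h⟩ ⟨hQ', rfl⟩

end GPVD

/-! ### The equivalence of the four conditions -/

theorem theorem3p12 {R : Type u} {K : Type v} [CommRing R] [IsDomain R] [Field K] [Algebra R K]
    [IsFractionRing R K] (hR : ¬ IsField R) :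
    List.TFAE [
      IsTAFRing R ∧ overringConductor (completeIntegralClosure R K) ≠ ⊥,
      IsMoriDomain R K ∧ IsGPVD R K,
      ∃ (T : Type u) (_ : CommRing T) (_ : IsDedekindDomain T) (n : ℕ) (_ : 0 < n)
        (N : Fin n → Ideal T) (k : ∀ i, Subring (T ⧸ N i)) (ι : R →+* T),
        (∀ i, (N i).IsMaximal) ∧ Function.Injective N ∧ (∀ i, IsField (k i)) ∧
        Function.Injective ι ∧ ι.range = pullbackSubring N k,
      IsDedekindDomain (completeIntegralClosure R K) ∧
        IsArtinianRing (R ⧸ conductorBelow (completeIntegralClosure R K)) ∧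
        IsReduced (R ⧸ conductorBelow (completeIntegralClosure R K)) ∧
        IsArtinianRing
          (completeIntegralClosure R K ⧸ conductorAbove (completeIntegralClosure R K)) ∧
        IsReduced (completeIntegralClosure R K ⧸ conductorAbove (completeIntegralClosure R K)) ∧
        IsUnibranched (conductorQuotientMap (completeIntegralClosure R K))] := by
  have of_isPseudoDedekind : IsDedekindDomain (completeIntegralClosure R K) ∧
      IsPseudoDedekind R (completeIntegralClosure R K) →
      IsTAFRing R ∧ overringConductor (completeIntegralClosure R K) ≠ ⊥ := by
    rintro ⟨hD, h⟩
    refine ⟨h.isTAFRing hR, ?_⟩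
    obtain ⟨c, hc0, hc⟩ := h.exists_conductor
    refine (Submodule.ne_bot_iff _).2 ⟨algebraMap R K c, mem_overringConductor.2 fun t ht => ?_,
      (map_ne_zero_iff _ (IsFractionRing.injective R K)).2 hc0⟩
    obtain ⟨r, hr⟩ := hc ⟨t, ht⟩
    exact ⟨r, congrArg Subtype.val hr⟩
  have to_isPseudoDedekind : IsTAFRing R ∧ overringConductor (completeIntegralClosure R K) ≠ ⊥ →
      IsDedekindDomain (completeIntegralClosure R K) ∧
      IsPseudoDedekind R (completeIntegralClosure R K) := fun h =>
    h.1.isPseudoDedekind_completeIntegralClosure hR h.2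
  tfae_have 1 → 2 := by
    intro h
    obtain ⟨hD, h⟩ := to_isPseudoDedekind h
    exact ⟨h.isMoriDomain hR, h.isGPVD hR⟩
  tfae_have 2 → 1 := fun h =>
    of_isPseudoDedekind (h.2.isPseudoDedekind_completeIntegralClosure h.1)
  tfae_have 1 → 3 := by
    intro h
    obtain ⟨hD, h⟩ := to_isPseudoDedekind h
    -- Passing from `K` to `FractionRing R` puts the Dedekind domain into the universe of `R`.
    obtain ⟨hD', h'⟩ := h.completeIntegralClosure (FractionRing R)
    obtain ⟨n, hn, N, k, hN, hNinj, hk, hrange⟩ := h'.exists_pullbackSubring hR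
    exact ⟨_, _, hD', n, hn, N, k, algebraMap R _, hN, hNinj, hk, h'.injective, hrange⟩
  tfae_have 3 → 1 := by
    rintro ⟨T, _, _, n, -, N, k, ι, hN, hNinj, hk, hι, hrange⟩
    let _ := ι.toAlgebra
    have h : IsPseudoDedekind R T := .of_pullbackSubring hR hι hN hNinj hk hrange
    exact of_isPseudoDedekind (h.completeIntegralClosure K)
  tfae_have 1 → 4 := by
    intro h
    obtain ⟨hD, h⟩ := to_isPseudoDedekind h
    have hrad := h.isRadical_algebraConductor hR
    refine ⟨hD, ?_, ?_, ?_, ?_, h.isUnibranched_conductorQuotientMap hR⟩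
    · rw [conductorBelow_eq_comap]
      exact h.isArtinianRing_quotient_comap hR
    · rw [conductorBelow_eq_comap, ← Ideal.isRadical_iff_quotient_reduced]
      exact hrad.comap _
    · rw [conductorAbove_eq_algebraConductor]
      exact h.isArtinianRing_quotient_algebraConductor hR
    · rwa [conductorAbove_eq_algebraConductor, ← Ideal.isRadical_iff_quotient_reduced]
  tfae_have 4 → 1 := by
    rintro ⟨hD, hart, -, -, hred, hub⟩
    exact of_isPseudoDedekind ⟨hD, .of_conductorQuotientMap hR hart hred hub⟩
  tfae_finish
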